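/- **Theorem.** Let $n\ge 0$ be an integer, and let $B_n$ be the group (under composition) of the permutations $\sigma$ of $\pm[n]=\{\pm1,\dots,\pm n\}$ with $\sigma(-k)=-\sigma(k)$ for all $k$, with simple generators $s_0=(1\ \,{-1})$ and $s_i=(i\ \,i{+}1)({-i}\ \,{-(i{+}1)})$ for $1\le i\le n-1$. Let $\ell(w)$ be the minimal length of a word in the simple generators representing $w$ (such a minimal word is called reduced), and put $\mathrm{Des}(w)=\{i:\ell(s_iw)<\ell(w)\}\subseteq[0,n-1]$. Write $x\le_{\mathsf L}y$ (left weak order) if some reduced word for $y$ has a reduced word for $x$ as a suffix; a set $X\subseteq B_n$ is *convex* if $x,y\in X$ and $x\le_{\mathsf L}z\le_{\mathsf L}y$ imply $z\in X$. A set $X\subseteq B_n$ is *ascent-compatible* if for all $u,v\in X$ and all $i,j\in[0,n-1]$ with $i\notin\mathrm{Des}(u)$, $j\notin\mathrm{Des}(v)$ and $u^{-1}s_iu=v^{-1}s_jv$, we have $s_iu\in X$ if and only if $s_jv\in X$. Let $\mathcal A_n^B\subseteq B_n$ be the set of *signed arc permutations*: those $\sigma$ whose one-line notation $\sigma(1)\cdots\sigma(n)$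 is a shuffle of a word $a_1\cdots a_p$ over $[n]$ and a word $b_1\cdots b_{n-p}$ over $-[n]$ such that $a_{i+1}\equiv a_i+1$ and $b_{j+1}\equiv b_j+1\pmod n$ for all $1\le i\le p-1$ and $1\le j\le n-p-1$, and $a_1\equiv -b_1+1\pmod n$ if both words are nonempty. Let $H_n^B(0)$ be the $\mathbb C$-algebra generated by $\pi_0,\dots,\pi_{n-1}$ with relations $\pi_i^2=-\pi_i$; $\pi_i\pi_j=\pi_j\pi_i$ for $|i-j|\ge2$; $\pi_i\pi_{i+1}\pi_i=\pi_{i+1}\pi_i\pi_{i+1}$ for $1\le i\le n-2$; and $\pi_0\pi_1\pi_0\pi_1=\pi_1\pi_0\pi_1\pi_0$ (if $n\ge 2$). For $I\subseteq[0,n-1]$ let $\mathcal S_I^B$ be the one-dimensional $H_n^B(0)$-module on which $\pi_j$ acts as $-1$ if $j\in I$ and as $0$ if $j\notin I$, and let $$F_I^B=\sum_{\substack{0=i_0\le i_1\le\cdots\le i_n\\ j\in I\Rightarrow i_j<i_{j+1}}}x_{i_1}\cdots x_{i_n}.$$ Let $\mathrm{ch}^B$ be the homomorphism from the Grothendieck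 group of finite-dimensional $H_n^B(0)$-modules (the free abelian group on isomorphism classes modulo $[M]-[N]+[P]=0$ for short exact sequences $0\to M\to N\to P\to0$) to formal power series in $x_0,x_1,\dots$ with $\mathrm{ch}^B([\mathcal S_I^B])=F_I^B$ for all $I$. For $X\subseteq B_n$ let $\mathcal Q(X)=\sum_{x\in X}F^B_{\mathrm{Des}(x^{-1})}$ and $X^{-1}=\{x^{-1}:x\in X\}$. Then: 1. $\mathcal A_n^B$ is ascent-compatible. 2. If $n\ge3$, then $\mathcal A_n^B$ is not convex in the left weak order. 3. The complex vector space $\mathbb C\mathcal A_n^B$ with basis $\mathcal A_n^B$ is an $H_n^B(0)$-module under the action determined, for $x\in\mathcal A_n^B$, by $$\pi_i\,x=\begin{cases}-x&\text{if } i\in\mathrm{Des}(x),\\ 0&\text{if } i\notin\mathrm{Des}(x)\text{ and } s_ix\notin\mathcal A_n^B,\\ s_ix&\text{if } i\notin\mathrm{Des}(x)\text{ and } s_ix\in\mathcal A_n^B,\end{cases}$$ and $\mathrm{ch}^B(\mathbb C\mathcal A_n^B)=\mathcal Q((\mathcal A_n^B)^{-1})$. -/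

import Mathlib

open scoped Pointwise

noncomputable section

/-! ### Words, length, descents and the left weak order

`s : ι → W` is the family of simple generators of a group `W`. -/

section Coxeter

variable {W ι : Type*} [Group W] (s : ι → W)

/-- The length of `w`: the minimal number of letters in a word over the simple generators that
represents `w`. -/
def wordLength (w : W) : ℕ :=
  sInf {k | ∃ l : List ι, l.length = k ∧ (l.map s).prod = w}

/-- The word `l` is a reduced word for `w`. -/
def IsReducedWord (l : List ι) (w : W) : Prop :=
  (l.map s).prod = w ∧ l.length = wordLength s w

/-- The set `Des(w)` of (left) descents of `w`. -/
def Des (w : W) : Set ι :=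
  {i | wordLength s (s i * w) < wordLength s w}

/-- `x ≤_L y`: some reduced word for `y` has a reduced word for `x` as a suffix. -/
def LeftWeakLE (x y : W) : Prop :=
  ∃ l₁ l₂ : List ι, IsReducedWord s (l₁ ++ l₂) y ∧ IsReducedWord s l₂ x

/-- Convexity in the left weak order. -/
def LeftWeakConvex (X : Set W) : Prop :=
  ∀ x ∈ X, ∀ y ∈ X, LeftWeakLE s x y → ∀ z, LeftWeakLE s x z → LeftWeakLE s z y → z ∈ X

/-- The quadruple `(u, v, s i, s j)` is aligned. -/
def Aligned (u v : W) (i j : ι) : Prop :=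
  i ∉ Des s u ∧ j ∉ Des s v ∧ u⁻¹ * s i * u = v⁻¹ * s j * v

/-- `X` is ascent-compatible. -/
def AscentCompatible (X : Set W) : Prop :=
  ∀ u ∈ X, ∀ v ∈ X, ∀ i j : ι, Aligned s u v i j → (s i * u ∈ X ↔ s j * v ∈ X)

open Classical in
/-- The linear operator `π_i` on `ℂX`, the vector space with basis `X`. -/
def piOp (X : Set W) (i : ι) : Module.End ℂ (X →₀ ℂ) :=
  Finsupp.linearCombination ℂ fun x : X =>
    if i ∈ Des s (x : W) then -Finsupp.single x (1 : ℂ)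
    else if h : s i * (x : W) ∈ X then Finsupp.single (⟨s i * (x : W), h⟩ : X) (1 : ℂ)
    else 0

end Coxeter

/-! ### The hyperoctahedral group -/

/-- The set `±[n] = {±1, …, ±n}`. -/
abbrev PM (n : ℕ) : Type := {k : ℤ // k ∈ (Finset.Icc (-(n : ℤ)) n).erase 0}

namespace PM

instance (n : ℕ) : Neg (PM n) :=
  ⟨fun k => ⟨-k.1, by have := k.2; simp only [Finset.mem_erase, Finset.mem_Icc] at *; omega⟩⟩

theorem coe_neg {n : ℕ} (k : PM n) : ((-k : PM n) : ℤ) = -(k : ℤ) := rfl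

theorem neg_neg {n : ℕ} (k : PM n) : - -k = k := Subtype.ext (by simp [coe_neg])

/-- The element `j + 1` of `[n]`, for `0 ≤ j < n`. -/
def pos {n : ℕ} (j : Fin n) : PM n :=
  ⟨(j : ℤ) + 1, by have := j.2; simp only [Finset.mem_erase, Finset.mem_Icc]; omega⟩

end PM

/-- The hyperoctahedral group `B_n`: the permutations `σ` of `±[n]` with `σ(-k) = -σ(k)`. -/
def hyperoctahedralGroup (n : ℕ) : Subgroup (Equiv.Perm (PM n)) where
  carrier := {σ | ∀ k, σ (-k) = -σ k}
  mul_mem' := by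
    intro a b ha hb k
    simp only [Set.mem_ofPred_eq] at ha hb
    simp [Equiv.Perm.mul_apply, ha, hb]
  one_mem' := fun _ => rfl
  inv_mem' := by
    intro a ha k
    simp only [Set.mem_ofPred_eq] at ha
    rw [Equiv.Perm.inv_eq_iff_eq, ha]
    simp

/-- The underlying permutation of the simple generator `s_i` of `B_n`: `s_0 = (1 -1)` and
`s_i = (i  i+1)(-i  -(i+1))` for `1 ≤ i ≤ n - 1`. -/
def simplePerm {n : ℕ} (i : Fin n) : Equiv.Perm (PM n) :=
  if (i : ℕ) = 0 then Equiv.swap (PM.pos i) (-PM.pos i)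
  else
    let p : Fin n := ⟨(i : ℕ) - 1, lt_of_le_of_lt (Nat.sub_le _ _) i.2⟩
    Equiv.swap (PM.pos p) (PM.pos i) * Equiv.swap (-PM.pos p) (-PM.pos i)

theorem simplePerm_neg {n : ℕ} (i : Fin n) (k : PM n) :
    simplePerm i (-k) = -simplePerm i k := by
  have hk := k.2
  have hi := i.2
  simp only [Finset.mem_erase, Finset.mem_Icc] at hk
  unfold simplePerm
  split_ifs with h <;>
  · apply Subtype.ext
    simp only [Equiv.Perm.mul_apply, Equiv.swap_apply_def, Subtype.ext_iff, PM.coe_neg, PM.pos,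
      apply_ite Subtype.val]
    split_ifs <;> omega

/-- The simple generators `s_0, …, s_{n-1}` of `B_n`. -/
def simpleB (n : ℕ) (i : Fin n) : hyperoctahedralGroup n :=
  ⟨simplePerm i, simplePerm_neg i⟩

/-! ### Signed arc permutations -/

/-- The one-line notation `σ(1) ⋯ σ(n)`. -/
def oneLine {n : ℕ} (σ : hyperoctahedralGroup n) : List ℤ :=
  List.ofFn fun j : Fin n => ((σ : Equiv.Perm (PM n)) (PM.pos j) : ℤ)

/-- `w` is a shuffle of the words `a` and `b` (which use disjoint sets of letters). -/
def IsShuffle (a b w : List ℤ) : Prop :=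
  w.filter (fun x => x ∉ b) = a ∧ w.filter (fun x => x ∉ a) = b

/-- The set `A_n^B` of signed arc permutations. -/
def signedArc (n : ℕ) : Set (hyperoctahedralGroup n) :=
  {σ | ∃ a b : List ℤ,
    (∀ x ∈ a, 1 ≤ x ∧ x ≤ n) ∧ (∀ y ∈ b, -(n : ℤ) ≤ y ∧ y ≤ -1) ∧
    IsShuffle a b (oneLine σ) ∧
    a.IsChain (fun x x' => x' ≡ x + 1 [ZMOD n]) ∧
    b.IsChain (fun y y' => y' ≡ y + 1 [ZMOD n]) ∧
    ∀ x ∈ a.head?, ∀ y ∈ b.head?, x ≡ -y + 1 [ZMOD n]}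

/-! ### The type-B 0-Hecke algebra -/

/-- The defining relations of `H_n^B(0)`. -/
inductive HeckeBRel (n : ℕ) : FreeAlgebra ℂ (Fin n) → FreeAlgebra ℂ (Fin n) → Prop
  | quad (i : Fin n) :
      HeckeBRel n (FreeAlgebra.ι ℂ i * FreeAlgebra.ι ℂ i) (-FreeAlgebra.ι ℂ i)
  | comm (i j : Fin n) (h : (i : ℕ) + 2 ≤ j) :
      HeckeBRel n (FreeAlgebra.ι ℂ i * FreeAlgebra.ι ℂ j)
        (FreeAlgebra.ι ℂ j * FreeAlgebra.ι ℂ i)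
  | braid (i j : Fin n) (hi : 1 ≤ (i : ℕ)) (h : (j : ℕ) = i + 1) :
      HeckeBRel n (FreeAlgebra.ι ℂ i * FreeAlgebra.ι ℂ j * FreeAlgebra.ι ℂ i)
        (FreeAlgebra.ι ℂ j * FreeAlgebra.ι ℂ i * FreeAlgebra.ι ℂ j)
  | braid₄ (i j : Fin n) (hi : (i : ℕ) = 0) (hj : (j : ℕ) = 1) :
      HeckeBRel n
        (FreeAlgebra.ι ℂ i * FreeAlgebra.ι ℂ j * FreeAlgebra.ι ℂ i * FreeAlgebra.ι ℂ j)
        (FreeAlgebra.ι ℂ j * FreeAlgebra.ι ℂ i * FreeAlgebra.ι ℂ j * FreeAlgebra.ι ℂ i)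

/-- The type-B 0-Hecke algebra `H_n^B(0)` over `ℂ`. -/
abbrev HeckeB (n : ℕ) : Type := RingQuot (HeckeBRel n)

/-- The generator `π_i` of `H_n^B(0)`. -/
def HeckeB.gen {n : ℕ} (i : Fin n) : HeckeB n :=
  RingQuot.mkAlgHom ℂ (HeckeBRel n) (FreeAlgebra.ι ℂ i)

open Classical in
/-- The character of `H_n^B(0)` through which it acts on the simple module `S_I^B`:
`π_j ↦ -1` if `j ∈ I`, and `π_j ↦ 0` otherwise. -/
def HeckeB.simpleChar {n : ℕ} (I : Set (Fin n)) : HeckeB n →ₐ[ℂ] ℂ :=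
  RingQuot.liftAlgHom ℂ ⟨FreeAlgebra.lift ℂ fun j => if j ∈ I then (-1 : ℂ) else 0, by
    intro x y h
    cases h <;> simp only [map_mul, map_neg, FreeAlgebra.lift_ι_apply] <;> split_ifs <;> norm_num⟩

open Classical in
theorem HeckeB.simpleChar_gen {n : ℕ} (I : Set (Fin n)) (j : Fin n) :
    HeckeB.simpleChar I (HeckeB.gen j) = if j ∈ I then (-1 : ℂ) else 0 := by
  simp [HeckeB.simpleChar, HeckeB.gen]

/-! ### Finite-dimensional modules and the Grothendieck group -/

/-- A finite-dimensional (left) module over a `ℂ`-algebra `A`. -/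
structure FDModule (A : Type) [Ring A] [Algebra ℂ A] : Type 1 where
  carrier : Type
  [addCommGroup : AddCommGroup carrier]
  [moduleC : Module ℂ carrier]
  [module : Module A carrier]
  [isScalarTower : IsScalarTower ℂ A carrier]
  [finite : Module.Finite ℂ carrier]

attribute [instance] FDModule.addCommGroup FDModule.moduleC FDModule.module
  FDModule.isScalarTower FDModule.finite

section Grothendieck

variable (A : Type) [Ring A] [Algebra ℂ A]

variable {A} in
/-- The module given by a representation `ρ : A → End(V)`, that is, `a • v = ρ(a)(v)`. -/
def FDModule.ofRep {V : Type} [AddCommGroup V] [Module ℂ V] [Module.Finite ℂ V]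
    (ρ : A →ₐ[ℂ] Module.End ℂ V) : FDModule A :=
  letI : Module A V := Module.compHom V ρ.toRingHom
  haveI : IsScalarTower ℂ A V := ⟨fun c a v => by
    change ρ (c • a) v = c • ρ a v
    rw [map_smul, LinearMap.smul_apply]⟩
  { carrier := V }

/-- The elements `[M] - [N] + [P]` for the short exact sequences `0 → M → N → P → 0`. -/
def shortExactRelators : Set (FreeAbelianGroup (FDModule A)) :=
  {z | ∃ (M N P : FDModule A) (f : M.carrier →ₗ[A] N.carrier) (g : N.carrier →ₗ[A] P.carrier),
    Function.Injective f ∧ Function.Exact f g ∧ Function.Surjective g ∧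
    z = FreeAbelianGroup.of M - FreeAbelianGroup.of N + FreeAbelianGroup.of P}

/-- The Grothendieck group of finite-dimensional `A`-modules. (Isomorphic modules are identified
by the relators with `P = 0`.) -/
abbrev GrothendieckGroup₀ : Type 1 :=
  FreeAbelianGroup (FDModule A) ⧸ AddSubgroup.closure (shortExactRelators A)

variable {A} in
/-- The class `[M]` in the Grothendieck group. -/
def FDModule.cls (M : FDModule A) : GrothendieckGroup₀ A :=
  QuotientAddGroup.mk (FreeAbelianGroup.of M)

end Grothendieck

/-- The one-dimensional simple `H_n^B(0)`-module `S_I^B`. -/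
def simpleModuleB {n : ℕ} (I : Set (Fin n)) : FDModule (HeckeB n) :=
  FDModule.ofRep ((Algebra.lmul ℂ ℂ).comp (HeckeB.simpleChar I))

/-! ### Type-B quasisymmetric functions and the characteristic map -/

/-- The sequences `0 = i_0 ≤ i_1 ≤ ⋯ ≤ i_n` with `i_j < i_{j+1}` for all `j ∈ I`. -/
def admissibleSeq {n : ℕ} (I : Set (Fin n)) : Set (Fin (n + 1) → ℕ) :=
  {i | i 0 = 0 ∧ Monotone i ∧ ∀ j ∈ I, i j.castSucc < i j.succ}

/-- The type-B fundamental quasisymmetric function `F_I^B = ∑ x_{i_1} ⋯ x_{i_n}`, summed over the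
admissible sequences, as a formal power series in `x_0, x_1, …`: the coefficient of a monomial is
the number of admissible sequences that produce it. -/
def fundamentalB {n : ℕ} (I : Set (Fin n)) : MvPowerSeries ℕ ℂ := fun d =>
  (Set.ncard {i ∈ admissibleSeq I | ∑ j : Fin n, Finsupp.single (i j.succ) 1 = d} : ℂ)

/-- `𝒬(X) = ∑_{x ∈ X} F^B_{Des(x⁻¹)}`. -/
def QB {n : ℕ} (X : Set (hyperoctahedralGroup n)) : MvPowerSeries ℕ ℂ :=
  ∑ᶠ x ∈ X, fundamentalB (Des (simpleB n) x⁻¹)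

/-- The trace of the action of `a` is additive on short exact sequences. -/
theorem trace_shortExact {A : Type} [Ring A] [Algebra ℂ A] {M N P : FDModule A}
    (f : M.carrier →ₗ[A] N.carrier) (g : N.carrier →ₗ[A] P.carrier)
    (hf : Function.Injective f) (hfg : Function.Exact f g) (hg : Function.Surjective g) (a : A) :
    LinearMap.trace ℂ N.carrier (Algebra.lsmul ℂ ℂ N.carrier a) =
      LinearMap.trace ℂ M.carrier (Algebra.lsmul ℂ ℂ M.carrier a) +
      LinearMap.trace ℂ P.carrier (Algebra.lsmul ℂ ℂ P.carrier a) := by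
  let f' : M.carrier →ₗ[ℂ] N.carrier := f.restrictScalars ℂ
  let g' : N.carrier →ₗ[ℂ] P.carrier := g.restrictScalars ℂ
  obtain ⟨r, hr⟩ := f'.exists_leftInverse_of_injective (LinearMap.ker_eq_bot.2 hf)
  obtain ⟨q, hq⟩ := g'.exists_rightInverse_of_surjective (LinearMap.range_eq_top.2 hg)
  have hr' : ∀ x, r (f x) = x := fun x => LinearMap.congr_fun hr x
  have hq' : ∀ x, g (q x) = x := fun x => LinearMap.congr_fun hq x
  let r' : N.carrier →ₗ[ℂ] M.carrier := r ∘ₗ (LinearMap.id - q ∘ₗ g')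
  have hsplit : ∀ x, f (r' x) + q (g x) = x := by
    intro x
    obtain ⟨y, hy⟩ := (hfg (x - q (g x))).1 (by rw [map_sub, hq', sub_self])
    have : r' x = y := by
      change r (x - q (g x)) = y
      rw [← hy, hr']
    rw [this, hy, sub_add_cancel]
  have hr'f : ∀ x, r' (f x) = x := by
    intro x
    change r (f x - q (g (f x))) = x
    rw [hfg.apply_apply_eq_zero, map_zero, sub_zero, hr']
  have h1 : Algebra.lsmul ℂ ℂ N.carrier a =
      f' ∘ₗ (Algebra.lsmul ℂ ℂ M.carrier a ∘ₗ r') +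
        (Algebra.lsmul ℂ ℂ N.carrier a ∘ₗ q) ∘ₗ g' := by
    ext x
    change a • x = f (a • r' x) + a • q (g x)
    rw [map_smul, ← smul_add, hsplit]
  have h2 : (Algebra.lsmul ℂ ℂ M.carrier a ∘ₗ r') ∘ₗ f' = Algebra.lsmul ℂ ℂ M.carrier a := by
    ext x
    change a • r' (f x) = a • x
    rw [hr'f]
  have h3 : g' ∘ₗ (Algebra.lsmul ℂ ℂ N.carrier a ∘ₗ q) = Algebra.lsmul ℂ ℂ P.carrier a := by
    ext x
    change g (a • q x) = a • x
    rw [map_smul, hq']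
  conv_lhs => rw [h1]
  rw [map_add, LinearMap.trace_comp_comm', h2,
    LinearMap.trace_comp_comm' g' (Algebra.lsmul ℂ ℂ N.carrier a ∘ₗ q), h3]

/-- There is a homomorphism on the Grothendieck group with `[S_I^B] ↦ F_I^B` for all `I`. -/
theorem exists_chB (n : ℕ) : ∃ ch : GrothendieckGroup₀ (HeckeB n) →+ MvPowerSeries ℕ ℂ,
    ∀ I : Set (Fin n), ch (simpleModuleB I).cls = fundamentalB I := by
  classical
  let e (I : Set (Fin n)) : HeckeB n :=
    ((List.finRange n).map fun j =>
      if j ∈ I then -HeckeB.gen j else 1 + HeckeB.gen j).prod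
  have he : ∀ I K : Set (Fin n), HeckeB.simpleChar K (e I) = if I = K then 1 else 0 := by
    intro I K
    have h1 : HeckeB.simpleChar K (e I) =
        ∏ j : Fin n, (if (j ∈ I ↔ j ∈ K) then (1 : ℂ) else 0) := by
      rw [← List.prod_ofFn, List.ofFn_eq_map, map_list_prod, List.map_map]
      congr 1
      refine List.map_congr_left fun j _ => ?_
      by_cases hI : j ∈ I <;> by_cases hK : j ∈ K <;>
        simp [hI, hK, HeckeB.simpleChar_gen]
    rw [h1, Finset.prod_ite_zero]
    simp [Set.ext_iff]
  let φ : FreeAbelianGroup (FDModule (HeckeB n)) →+ MvPowerSeries ℕ ℂ :=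
    FreeAbelianGroup.lift fun M => ∑ I : Set (Fin n),
      LinearMap.trace ℂ M.carrier (Algebra.lsmul ℂ ℂ M.carrier (e I)) • fundamentalB I
  have hφ : AddSubgroup.closure (shortExactRelators (HeckeB n)) ≤ φ.ker := by
    rw [AddSubgroup.closure_le]
    rintro z ⟨M, N, P, f, g, hf, hfg, hg, rfl⟩
    change φ _ = 0
    simp only [φ, map_sub, map_add, FreeAbelianGroup.lift_apply_of]
    rw [← Finset.sum_sub_distrib, ← Finset.sum_add_distrib]
    refine Finset.sum_eq_zero fun I _ => ?_
    rw [trace_shortExact f g hf hfg hg, add_smul]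
    abel
  refine ⟨QuotientAddGroup.lift _ φ hφ, fun K => ?_⟩
  have htr : ∀ a : HeckeB n, LinearMap.trace ℂ (simpleModuleB K).carrier
      (Algebra.lsmul ℂ ℂ (simpleModuleB K).carrier a) = HeckeB.simpleChar K a := by
    intro a
    change LinearMap.trace ℂ ℂ (Algebra.lmul ℂ ℂ (HeckeB.simpleChar K a)) = _
    exact Algebra.trace_self_apply _
  change φ (FreeAbelianGroup.of _) = _
  simp only [φ, FreeAbelianGroup.lift_apply_of, htr, he]
  simp

/-- The type-B quasisymmetric characteristic `ch^B`: the homomorphism on the Grothendieck group of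
`H_n^B(0)` with `ch^B([S_I^B]) = F_I^B` for all `I`. (It is determined by this property, since every
simple module is isomorphic to some `S_I^B`.) -/
def chB (n : ℕ) : GrothendieckGroup₀ (HeckeB n) →+ MvPowerSeries ℕ ℂ :=
  Classical.choose (exists_chB n)

theorem chB_simple {n : ℕ} (I : Set (Fin n)) :
    chB n (simpleModuleB I).cls = fundamentalB I :=
  Classical.choose_spec (exists_chB n) I

end

/-! The geometry of `B_n` is turned into comparisons of integers: the length of `w` is the number of
positive roots inverted by `w⁻¹`, so `i` is an ascent of `w` exactly when `w⁻¹` keeps the pair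
`(s_i(i+1), i+1)` in order. This pair is `(i, i+1)` for `i ≥ 1` and `(-1, 1)` for `i = 0`.

The heart of the matter is rigidity for `n ≥ 3`. An ascent `i ≥ 1` never stays inside the signed arc
permutations (`simpleB_mul_notMem_signedArc`), because exchanging cyclically consecutive letters
breaks a cyclic chain. An ascent `0`, which negates the letter `1`, stays inside exactly when that
letter is first or last in the one-line notation (`simpleB_zero_mul_mem_signedArc_iff`). For `n ≤ 2`
every element of `B_n` is a signed arc permutation.

Ascent-compatibility follows: the reflection `u⁻¹ s_0 u` remembers the position of the letter `1`,
and the criterion depends on nothing else. Convexity fails on the chain `1 ≤ s_1 s_0 ≤ s_{n-1} ⋯ s_1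
s_0`, whose ends are signed arc permutations while the middle is not.

For `n ≥ 3` the operators `π_i` with `i ≥ 1` are diagonal, so the 0-Hecke relations reduce to
knowing how `s_0` affects descents. Finally, each `π_i` is triangular with respect to length, with
the diagonal of `𝒮_{Des(x)}` at `x`. Peeling off basis vectors of least length writes the class of
the module as a sum of simple classes (`FDModule.cls_eq_sum_of_triangular`). -/

noncomputable section

/-! ### A criterion for length functions. -/

section Length

variable {W ι : Type*} [Group W] {s : ι → W}

/-- A function that vanishes at `1`, changes by at most one under left multiplication by a simple
generator and can always be lowered away from `1` is the length function. -/
theorem wordLength_eq_of_forall (L : W → ℕ) (hs : ∀ i, s i * s i = 1) (h1 : L 1 = 0)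
    (hup : ∀ i w, L (s i * w) ≤ L w + 1)
    (hdown : ∀ w, w ≠ 1 → ∃ i, L (s i * w) + 1 = L w) (w : W) : wordLength s w = L w := by
  have hle : ∀ l : List ι, L (l.map s).prod ≤ l.length := by
    intro l
    induction l with
    | nil => simp [h1]
    | cons i l ih =>
      rw [List.map_cons, List.prod_cons, List.length_cons]
      exact (hup i _).trans (by omega)
  have hex : ∀ k w, L w = k → ∃ l : List ι, l.length = k ∧ (l.map s).prod = w := by
    intro k
    induction k with
    | zero =>
      intro w hw
      refine ⟨[], rfl, ?_⟩
      by_contra hne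
      obtain ⟨i, hi⟩ := hdown w (fun h => hne (by simp [h]))
      omega
    | succ k ih =>
      intro w hw
      obtain ⟨i, hi⟩ := hdown w (fun h => by rw [h, h1] at hw; omega)
      obtain ⟨l, hl, hlw⟩ := ih (s i * w) (by omega)
      refine ⟨i :: l, by simp [hl], ?_⟩
      rw [List.map_cons, List.prod_cons, hlw, ← mul_assoc, hs, one_mul]
  refine le_antisymm (Nat.sInf_le (hex _ w rfl)) ?_
  obtain ⟨l, hl, hlw⟩ : wordLength s w ∈ {k | ∃ l : List ι, l.length = k ∧ (l.map s).prod = w} :=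
    Nat.sInf_mem ⟨_, hex _ w rfl⟩
  rw [← hl, ← hlw]
  exact hle l

end Length

/-! ### Elements of `±[n]` and the simple generators as maps of integers. -/

namespace PM

variable {n : ℕ}

theorem bounds (k : PM n) : -(n : ℤ) ≤ k.1 ∧ k.1 ≤ n ∧ k.1 ≠ 0 := by
  have := k.2
  simp only [Finset.mem_erase, Finset.mem_Icc] at this
  tauto

theorem coe_pos (j : Fin n) : ((pos j : PM n) : ℤ) = j + 1 := rfl

/-- The nonzero integer `z` with `|z| ≤ n`, as an element of `±[n]`. -/
def of (z : ℤ) (h : -(n : ℤ) ≤ z ∧ z ≤ n ∧ z ≠ 0) : PM n :=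
  ⟨z, by simp only [Finset.mem_erase, Finset.mem_Icc]; tauto⟩

theorem eq_pos_or_eq_neg_pos (k : PM n) : ∃ j : Fin n, k = pos j ∨ k = -pos j := by
  have hk := k.bounds
  refine ⟨⟨k.1.natAbs - 1, by omega⟩, ?_⟩
  simp only [Subtype.ext_iff, coe_neg, coe_pos]
  omega

theorem neg_lt_neg_iff (a b : PM n) : -a < -b ↔ b < a := by
  simp only [← Subtype.coe_lt_coe, coe_neg]
  omega

end PM

/-- The action of the simple generator `s_i` on integers. -/
def simpleVal (i : ℕ) (x : ℤ) : ℤ :=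
  if i = 0 then if x = 1 then -1 else if x = -1 then 1 else x
  else if x = i then i + 1 else if x = i + 1 then i
  else if x = -i then -(i + 1) else if x = -(i + 1) then -i else x

section Simple

variable {n : ℕ}

theorem coe_simplePerm (i : Fin n) (k : PM n) : (simplePerm i k : ℤ) = simpleVal i k := by
  have hk := k.bounds
  have hi := i.2
  unfold simplePerm simpleVal
  split_ifs with h <;>
  simp only [Equiv.Perm.mul_apply, Equiv.swap_apply_def, Subtype.ext_iff, PM.coe_neg, PM.pos,
      apply_ite Subtype.val] <;>
  split_ifs <;> omega

theorem simplePerm_simplePerm (i : Fin n) (k : PM n) : simplePerm i (simplePerm i k) = k := by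
  apply Subtype.ext
  rw [coe_simplePerm, coe_simplePerm]
  unfold simpleVal
  grind

theorem simpleB_mul_self (i : Fin n) : simpleB n i * simpleB n i = 1 :=
  Subtype.ext (Equiv.ext fun k => simplePerm_simplePerm i k)

theorem simpleB_mul_cancel (i : Fin n) (w : hyperoctahedralGroup n) :
    simpleB n i * (simpleB n i * w) = w := by
  rw [← mul_assoc, simpleB_mul_self, one_mul]

theorem simpleB_mul_apply (i : Fin n) (w : hyperoctahedralGroup n) (k : PM n) :
    (simpleB n i * w).1 k = simplePerm i (w.1 k) := rfl

theorem simpleB_mul_inv_apply (i : Fin n) (w : hyperoctahedralGroup n) (k : PM n) :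
    (simpleB n i * w).1⁻¹ k = w.1⁻¹ (simplePerm i k) := by
  rw [Equiv.Perm.inv_eq_iff_eq, simpleB_mul_apply]
  exact ((congrArg _ (w.1.apply_symm_apply _)).trans (simplePerm_simplePerm i k)).symm

theorem hyperoctahedral_apply_inv (w : hyperoctahedralGroup n) (k : PM n) : w.1 (w.1⁻¹ k) = k :=
  w.1.apply_symm_apply k

theorem hyperoctahedral_inv_apply (w : hyperoctahedralGroup n) (k : PM n) : w.1⁻¹ (w.1 k) = k :=
  w.1.symm_apply_apply k

theorem hyperoctahedral_inv_neg (w : hyperoctahedralGroup n) (k : PM n) :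
    w.1⁻¹ (-k) = -w.1⁻¹ k := (w⁻¹).2 k

theorem simplePerm_ne_pos (i : Fin n) : simplePerm i (PM.pos i) ≠ PM.pos i := by
  rw [Ne, Subtype.ext_iff, coe_simplePerm, PM.coe_pos]
  unfold simpleVal
  split_ifs <;> omega

/-- `PM.pos i` has value `i + 1`, so the pair `(s_i(i+1), i+1)` encodes the `i`-th simple root for
`i = 0` and `i ≥ 1` alike. -/
theorem simplePerm_pos_lt (i : Fin n) : simplePerm i (PM.pos i) < PM.pos i := by
  rw [← Subtype.coe_lt_coe, coe_simplePerm, PM.coe_pos]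
  unfold simpleVal
  split_ifs <;> omega

/-- `s_i` is monotone except on the pairs that it inverts. -/
theorem simplePerm_lt_iff (i : Fin n) (x y : PM n)
    (h₁ : ¬(x = simplePerm i (PM.pos i) ∧ y = PM.pos i))
    (h₂ : ¬(x = -PM.pos i ∧ y = -simplePerm i (PM.pos i)))
    (h₃ : ¬(x = PM.pos i ∧ y = simplePerm i (PM.pos i)))
    (h₄ : ¬(x = -simplePerm i (PM.pos i) ∧ y = -PM.pos i)) :
    simplePerm i x < simplePerm i y ↔ x < y := by
  have hx := x.bounds
  have hy := y.bounds
  rw [← Subtype.coe_lt_coe, ← Subtype.coe_lt_coe]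
  simp only [Subtype.ext_iff, PM.coe_neg, coe_simplePerm, PM.coe_pos] at *
  generalize x.1 = a at *
  generalize y.1 = b at *
  obtain ⟨i, hi⟩ := i
  simp only at *
  by_cases h0 : i = 0
  · subst h0
    simp only [simpleVal, if_true, Nat.cast_zero, zero_add] at *
    split_ifs <;> omega
  · have e1 : simpleVal i ((i : ℤ) + 1) = i := by simp [simpleVal, h0]
    rw [e1] at h₁ h₂ h₃ h₄
    simp only [simpleVal, h0, if_false]
    split_ifs <;> omega

end Simple

/-! ### The length function of the hyperoctahedral group -/

section BLength

variable {n : ℕ}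

/-- The pairs `x < y` that `w⁻¹` inverts. -/
def invPairs (w : hyperoctahedralGroup n) : Finset (PM n × PM n) :=
  Finset.univ.filter fun q => q.1 < q.2 ∧ w.1⁻¹ q.2 < w.1⁻¹ q.1

/-- Pairs `(-y, y)` are counted twice; the other ones come in couples `(x, y)`, `(-y, -x)`. -/
def pairWeight (q : PM n × PM n) : ℕ := if q.1 = -q.2 then 2 else 1

/-- Twice the number of positive roots inverted by `w⁻¹`. -/
def invWeight (w : hyperoctahedralGroup n) : ℕ := ∑ q ∈ invPairs w, pairWeight q

/-- Relabelling by `s_i` preserves order except on the simple pair and its negative. Since `i` is an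
ascent, these are not inverted by `w⁻¹` and become inverted. -/
theorem invPairs_simpleB_mul (i : Fin n) (w : hyperoctahedralGroup n)
    (h : w.1⁻¹ (simplePerm i (PM.pos i)) < w.1⁻¹ (PM.pos i)) :
    invPairs (simpleB n i * w) =
      {(simplePerm i (PM.pos i), PM.pos i), (-PM.pos i, -simplePerm i (PM.pos i))} ∪
        (invPairs w).map ((Equiv.prodCongr (simplePerm i) (simplePerm i)).toEmbedding) := by
  have hlt := simplePerm_pos_lt i
  ext ⟨x, y⟩
  simp only [invPairs, Finset.mem_filter, Finset.mem_univ, true_and, Finset.mem_union,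
    Finset.mem_insert, Finset.mem_singleton, Prod.mk.injEq, Finset.mem_map_equiv,
    simpleB_mul_inv_apply]
  have hsymm : ∀ z, (simplePerm i).symm z = simplePerm i z := fun z => by
    rw [Equiv.symm_apply_eq, simplePerm_simplePerm]
  simp only [Equiv.prodCongr_symm, Equiv.prodCongr_apply, Prod.map, hsymm]
  by_cases h₁ : x = simplePerm i (PM.pos i) ∧ y = PM.pos i
  · obtain ⟨rfl, rfl⟩ := h₁
    simp only [simplePerm_simplePerm, hlt, h, and_self, true_or]
  by_cases h₂ : x = -PM.pos i ∧ y = -simplePerm i (PM.pos i)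
  · obtain ⟨rfl, rfl⟩ := h₂
    simp only [simplePerm_simplePerm, simplePerm_neg, PM.neg_lt_neg_iff, hyperoctahedral_inv_neg,
      hlt, h, and_self, true_or, or_true]
  by_cases h₃ : x = PM.pos i ∧ y = simplePerm i (PM.pos i)
  · obtain ⟨rfl, rfl⟩ := h₃
    simp only [h₁, h₂, false_or, simplePerm_simplePerm, hlt.not_gt, h.not_gt, and_false]
  by_cases h₄ : x = -simplePerm i (PM.pos i) ∧ y = -PM.pos i
  · obtain ⟨rfl, rfl⟩ := h₄
    simp only [h₁, h₂, false_or, simplePerm_simplePerm, simplePerm_neg, PM.neg_lt_neg_iff,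
      hyperoctahedral_inv_neg, hlt.not_gt, h.not_gt, and_false]
  simp only [h₁, h₂, false_or, simplePerm_lt_iff i x y h₁ h₂ h₃ h₄]

theorem invWeight_simpleB_mul (i : Fin n) (w : hyperoctahedralGroup n)
    (h : w.1⁻¹ (simplePerm i (PM.pos i)) < w.1⁻¹ (PM.pos i)) :
    invWeight (simpleB n i * w) = invWeight w + 2 := by
  have hlt := simplePerm_pos_lt i
  unfold invWeight
  rw [invPairs_simpleB_mul i w h, Finset.sum_union, Finset.sum_map, add_comm]
  · congr 1
    · refine Finset.sum_congr rfl fun q _ => ?_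
      simp only [pairWeight, Equiv.coe_toEmbedding, Equiv.prodCongr_apply, Prod.map,
        ← simplePerm_neg, EmbeddingLike.apply_eq_iff_eq]
    -- For `i = 0` the two new pairs coincide as `(-1, 1)`, of weight 2; for `i ≥ 1` they are
    -- distinct, of weight 1 each.
    · by_cases hp : simplePerm i (PM.pos i) = -PM.pos i
      · rw [hp, PM.neg_neg, Finset.pair_eq_singleton, Finset.sum_singleton]
        simp [pairWeight]
      · rw [Finset.sum_pair]
        · have hp' : ¬ -PM.pos i = simplePerm i (PM.pos i) := fun h => hp h.symm
          simp [pairWeight, hp, hp', PM.neg_neg]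
        · simp [hp]
  · rw [Finset.disjoint_left]
    rintro ⟨x, y⟩ hq hq'
    simp only [Finset.mem_map, invPairs, Finset.mem_filter, Finset.mem_univ, true_and,
      Equiv.coe_toEmbedding, Equiv.prodCongr_apply, Prod.map, Prod.mk.injEq, Prod.exists] at hq'
    obtain ⟨x, y, ⟨hxy, -⟩, rfl, rfl⟩ := hq'
    simp only [Finset.mem_insert, Finset.mem_singleton, Prod.mk.injEq, ← simplePerm_neg,
      EmbeddingLike.apply_eq_iff_eq] at hq
    rcases hq with ⟨rfl, hy⟩ | ⟨hx, rfl⟩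
    · rw [← simplePerm_simplePerm i y, hy] at hxy
      exact hlt.not_gt hxy
    · rw [← simplePerm_simplePerm i x, hx, simplePerm_neg, PM.neg_lt_neg_iff] at hxy
      exact hlt.not_gt hxy

theorem invWeight_one : invWeight (1 : hyperoctahedralGroup n) = 0 := by
  unfold invWeight
  refine Finset.sum_eq_zero fun q hq => ?_
  simp only [invPairs, Finset.mem_filter, Finset.mem_univ, true_and, OneMemClass.coe_one, inv_one,
    Equiv.Perm.coe_one, id_eq] at hq
  exact absurd hq.1 hq.2.not_gt

/-- Every `i` is either an ascent or a descent of `w`. -/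
theorem inv_apply_trichotomy (i : Fin n) (w : hyperoctahedralGroup n) :
    w.1⁻¹ (simplePerm i (PM.pos i)) < w.1⁻¹ (PM.pos i) ∨
      w.1⁻¹ (PM.pos i) < w.1⁻¹ (simplePerm i (PM.pos i)) :=
  lt_or_gt_of_ne fun h => simplePerm_ne_pos i (w.1⁻¹.injective h)

theorem invWeight_simpleB_mul_of_gt (i : Fin n) (w : hyperoctahedralGroup n)
    (h : w.1⁻¹ (PM.pos i) < w.1⁻¹ (simplePerm i (PM.pos i))) :
    invWeight (simpleB n i * w) + 2 = invWeight w := by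
  rw [← invWeight_simpleB_mul i (simpleB n i * w), simpleB_mul_cancel]
  rwa [simpleB_mul_inv_apply, simpleB_mul_inv_apply, simplePerm_simplePerm]

/-- The ascents make `w⁻¹` increasing on `[n]` with `w⁻¹(1) > 0`, which leaves only the identity.
This is the dominant chamber meeting its orbit once. -/
theorem eq_one_of_forall_ascent (w : hyperoctahedralGroup n)
    (h : ∀ i, w.1⁻¹ (simplePerm i (PM.pos i)) < w.1⁻¹ (PM.pos i)) : w = 1 := by
  have hstep : ∀ (k j : ℕ) (hjk : j + k < n),
      (w.1⁻¹ (PM.pos ⟨j, by omega⟩) : ℤ) + k ≤ w.1⁻¹ (PM.pos ⟨j + k, hjk⟩) := by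
    intro k
    induction k with
    | zero => intro j hjk; simp
    | succ k ih =>
      intro j hjk
      have h1 := ih j (by omega)
      have h2 := h ⟨j + k + 1, hjk⟩
      have h3 : simplePerm ⟨j + k + 1, hjk⟩ (PM.pos ⟨j + k + 1, hjk⟩) =
          PM.pos ⟨j + k, by omega⟩ := by
        apply Subtype.ext
        rw [coe_simplePerm]
        simp only [PM.coe_pos, simpleVal]
        push_cast
        split_ifs <;> omega
      rw [h3, ← Subtype.coe_lt_coe] at h2
      have h4 : (⟨j + (k + 1), hjk⟩ : Fin n) = ⟨j + k + 1, hjk⟩ := rfl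
      rw [h4]
      push_cast
      omega
  have hfix : ∀ j : Fin n, w.1⁻¹ (PM.pos j) = PM.pos j := by
    rintro ⟨j, hj⟩
    -- Squeeze: climbing from `w⁻¹(1) ≥ 1` gives `w⁻¹(j+1) ≥ j+1`, and the climb to `w⁻¹(n) ≤ n`
    -- gives the reverse bound.
    have h1 := hstep j 0 (by omega)
    have h2 := hstep (n - 1 - j) j (by omega)
    have h3 := (w.1⁻¹ (PM.pos ⟨j + (n - 1 - j), by omega⟩)).bounds
    have h4 := h ⟨0, by omega⟩
    have h5 : simplePerm ⟨0, by omega⟩ (PM.pos ⟨0, by omega⟩) = -(PM.pos ⟨0, by omega⟩ : PM n) := by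
      apply Subtype.ext
      rw [coe_simplePerm]
      simp [PM.coe_pos, PM.coe_neg, simpleVal]
    rw [h5, hyperoctahedral_inv_neg, ← Subtype.coe_lt_coe, PM.coe_neg] at h4
    apply Subtype.ext
    simp only [zero_add, PM.coe_pos] at *
    omega
  apply inv_injective
  rw [inv_one]
  refine Subtype.ext (Equiv.ext fun k => ?_)
  obtain ⟨j, rfl | rfl⟩ := k.eq_pos_or_eq_neg_pos
  · exact hfix j
  · exact (hyperoctahedral_inv_neg w _).trans (by rw [hfix]; rfl)

theorem wordLength_simpleB (w : hyperoctahedralGroup n) :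
    wordLength (simpleB n) w = invWeight w / 2 := by
  refine wordLength_eq_of_forall (fun w => invWeight w / 2) simpleB_mul_self
    (by simp [invWeight_one]) (fun i w => ?_) (fun w hw => ?_) w
  · rcases inv_apply_trichotomy i w with h | h
    · have := invWeight_simpleB_mul i w h
      omega
    · have := invWeight_simpleB_mul_of_gt i w h
      omega
  · by_contra! hne
    refine hw (eq_one_of_forall_ascent w fun i => (inv_apply_trichotomy i w).resolve_right fun h => ?_)
    have := invWeight_simpleB_mul_of_gt i w h
    exact hne i (by omega)

theorem mem_Des_simpleB (i : Fin n) (w : hyperoctahedralGroup n) :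
    i ∈ Des (simpleB n) w ↔ w.1⁻¹ (PM.pos i) < w.1⁻¹ (simplePerm i (PM.pos i)) := by
  simp only [Des, Set.mem_ofPred_eq, wordLength_simpleB]
  rcases inv_apply_trichotomy i w with h | h
  · have := invWeight_simpleB_mul i w h
    exact iff_of_false (by omega) h.not_gt
  · have := invWeight_simpleB_mul_of_gt i w h
    exact iff_of_true (by omega) h

theorem notMem_Des_simpleB (i : Fin n) (w : hyperoctahedralGroup n) :
    i ∉ Des (simpleB n) w ↔ w.1⁻¹ (simplePerm i (PM.pos i)) < w.1⁻¹ (PM.pos i) := by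
  rw [mem_Des_simpleB]
  rcases inv_apply_trichotomy i w with h | h <;> simp only [h, h.not_gt, not_true, not_false_eq_true]

theorem wordLength_simpleB_mul {i : Fin n} {w : hyperoctahedralGroup n}
    (h : i ∉ Des (simpleB n) w) :
    wordLength (simpleB n) (simpleB n i * w) = wordLength (simpleB n) w + 1 := by
  rw [notMem_Des_simpleB] at h
  have := invWeight_simpleB_mul i w h
  rw [wordLength_simpleB, wordLength_simpleB]
  omega

end BLength

/-! ### Words of signed arc permutations -/

/-- The subword of positive letters. -/
def posLetters (w : List ℤ) : List ℤ := w.filter fun x => 0 < x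

/-- The subword of negative letters. -/
def negLetters (w : List ℤ) : List ℤ := w.filter fun x => x < 0

/-- Consecutive letters of `l` increase by `1` modulo `n`. -/
def CyclicChain (n : ℕ) (l : List ℤ) : Prop := l.IsChain fun x y : ℤ => (y : ZMod n) = x + 1

/-- The condition on one-line notations that defines signed arc permutations. -/
def ArcWord (n : ℕ) (w : List ℤ) : Prop :=
  CyclicChain n (posLetters w) ∧ CyclicChain n (negLetters w) ∧
    ∀ x ∈ (posLetters w).head?, ∀ y ∈ (negLetters w).head?, (x : ZMod n) = -y + 1

section Words

variable {n : ℕ}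

theorem cyclicChain_iff (l : List ℤ) :
    CyclicChain n l ↔ l.IsChain (fun x x' => x' ≡ x + 1 [ZMOD n]) := by
  unfold CyclicChain
  simp only [← ZMod.intCast_eq_intCast_iff, Int.cast_add, Int.cast_one]

theorem ZMod.one_ne_zero_of_two_le (hn : 2 ≤ n) : (1 : ZMod n) ≠ 0 := by
  have : Fact (1 < n) := ⟨hn⟩
  exact one_ne_zero

theorem ZMod.two_ne_zero_of_three_le (hn : 3 ≤ n) : (2 : ZMod n) ≠ 0 := by
  intro h
  have : ((2 : ℕ) : ZMod n) = 0 := by exact_mod_cast h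
  rw [ZMod.natCast_eq_zero_iff] at this
  exact absurd (Nat.le_of_dvd (by norm_num) this) (by omega)

/-- Integers of absolute difference less than `n` are determined by their class modulo `n`. -/
theorem ZMod.eq_of_intCast_eq {x y : ℤ} (h : (x : ZMod n) = y) (h₁ : x - y < n) (h₂ : y - x < n) :
    x = y := by
  rw [ZMod.intCast_eq_intCast_iff_dvd_sub] at h
  have := Int.eq_zero_of_abs_lt_dvd h (by rw [abs_lt]; omega)
  omega

/-- Only the two ends and the length of a cyclic chain matter when chains are cut or glued, and the
length ties the ends together modulo `n`. -/
theorem CyclicChain.eq_nil_or_ends {l : List ℤ} (h : CyclicChain n l) :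
    l = [] ∨ ∃ x y, l.head? = some x ∧ l.getLast? = some y ∧ (y : ZMod n) = x + l.length - 1 := by
  induction l with
  | nil => exact Or.inl rfl
  | cons a l ih =>
    right
    obtain ⟨h₁, h₂⟩ := List.isChain_cons.1 h
    rcases ih h₂ with rfl | ⟨x, y, hx, hy, hxy⟩
    · exact ⟨a, a, by simp⟩
    · refine ⟨a, y, by simp, by simp [List.getLast?_cons, hy], ?_⟩
      have := h₁ x hx
      rw [hxy, this, List.length_cons]
      push_cast
      ring

theorem length_posLetters_add_length_negLetters {w : List ℤ} (h : ∀ x ∈ w, x ≠ 0) :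
    (posLetters w).length + (negLetters w).length = w.length := by
  induction w with
  | nil => rfl
  | cons a w ih =>
    have := ih fun x hx => h x (List.mem_cons_of_mem _ hx)
    have ha := h a List.mem_cons_self
    unfold posLetters negLetters at *
    rcases lt_or_gt_of_ne ha with h | h <;> simp [h, h.not_gt] <;> omega

theorem eq_nil_of_posLetters_negLetters {w : List ℤ} (h : ∀ x ∈ w, x ≠ 0) (h₁ : posLetters w = [])
    (h₂ : negLetters w = []) : w = [] := by
  have := length_posLetters_add_length_negLetters h
  rw [h₁, h₂] at this
  exact List.length_eq_zero_iff.1 this.symm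

/-- If letters of one sign lie on both sides of `1`, one of the two chains cannot be a chain both
before and after the change. If one side is purely positive and the other purely negative, the
condition on the two heads (with the chain condition, when the positive side comes first) fails
because `1 ≠ 0`. Conversely, when `1` is first the new conditions are immediate; when it is last
they hold because the chains use `n` letters in all. -/
theorem arcWord_append_neg_one {w₁ w₂ : List ℤ} (hn : 2 ≤ n) (h₁ : ∀ x ∈ w₁, x ≠ 0)
    (h₂ : ∀ x ∈ w₂, x ≠ 0) (hlen : w₁.length + w₂.length + 1 = n)
    (hw : ArcWord n (w₁ ++ 1 :: w₂)) :
    ArcWord n (w₁ ++ -1 :: w₂) ↔ w₁ = [] ∨ w₂ = [] := by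
  have h10 := ZMod.one_ne_zero_of_two_le hn
  have hp : ∀ u v : List ℤ, posLetters (u ++ 1 :: v) = posLetters u ++ 1 :: posLetters v := by
    simp [posLetters]
  have hn' : ∀ u v : List ℤ, negLetters (u ++ 1 :: v) = negLetters u ++ negLetters v := by
    simp [negLetters]
  have hp' : ∀ u v : List ℤ, posLetters (u ++ -1 :: v) = posLetters u ++ posLetters v := by
    simp [posLetters]
  have hn'' : ∀ u v : List ℤ, negLetters (u ++ -1 :: v) = negLetters u ++ -1 :: negLetters v := by
    simp [negLetters]
  have e₁ : w₁ = [] ↔ posLetters w₁ = [] ∧ negLetters w₁ = [] :=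
    ⟨by rintro rfl; exact ⟨rfl, rfl⟩, fun h => eq_nil_of_posLetters_negLetters h₁ h.1 h.2⟩
  have e₂ : w₂ = [] ↔ posLetters w₂ = [] ∧ negLetters w₂ = [] :=
    ⟨by rintro rfl; exact ⟨rfl, rfl⟩, fun h => eq_nil_of_posLetters_negLetters h₂ h.1 h.2⟩
  have l₁ := length_posLetters_add_length_negLetters h₁
  have l₂ := length_posLetters_add_length_negLetters h₂
  -- The letter count `n` vanishes in `ZMod n`; this closes the cycle when `1` is the last letter.
  have hcast : ((posLetters w₁).length : ZMod n) + (negLetters w₁).length +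
      ((posLetters w₂).length + (negLetters w₂).length) + 1 = 0 := by
    rw [← ZMod.natCast_self n, ← hlen, ← l₁, ← l₂]
    push_cast
    ring
  rw [e₁, e₂]
  unfold ArcWord at *
  rw [hp, hn'] at hw
  rw [hp', hn'']
  generalize posLetters w₁ = a₁ at *
  generalize posLetters w₂ = a₂ at *
  generalize negLetters w₁ = b₁ at *
  generalize negLetters w₂ = b₂ at *
  unfold CyclicChain at hw ⊢
  simp only [List.isChain_append, List.isChain_cons] at hw ⊢
  obtain ⟨⟨ca₁, ⟨ha₂, ca₂⟩, ha₁⟩, ⟨cb₁, cb₂, hb⟩, hab⟩ := hw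
  have Ea₁ := CyclicChain.eq_nil_or_ends (n := n) ca₁
  have Ea₂ := CyclicChain.eq_nil_or_ends (n := n) ca₂
  have Eb₁ := CyclicChain.eq_nil_or_ends (n := n) cb₁
  have Eb₂ := CyclicChain.eq_nil_or_ends (n := n) cb₂
  simp only [ca₁, ca₂, cb₁, cb₂, true_and]
  -- Sixteen cases, according to which of the four pieces are empty; each is linear arithmetic in
  -- `ZMod n` between the ends.
  rcases Ea₁ with rfl | ⟨x₁, y₁, hx₁, hy₁, hxy₁⟩ <;>
  rcases Ea₂ with rfl | ⟨x₂, y₂, hx₂, hy₂, hxy₂⟩ <;>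
  rcases Eb₁ with rfl | ⟨x₃, y₃, hx₃, hy₃, hxy₃⟩ <;>
  rcases Eb₂ with rfl | ⟨x₄, y₄, hx₄, hy₄, hxy₄⟩ <;>
  simp_all [List.head?_append] <;> grind

/-- The letter right after `x` is congruent to `y`, hence is `y`. After the exchange `y` is followed
by `x`, so `x = y + 1 = x + 2` modulo `n`. -/
theorem CyclicChain.two_eq_zero_of_swap {l : List ℤ} {f : ℤ → ℤ} {x y : ℤ} (h : CyclicChain n l)
    (hf : CyclicChain n (l.map f)) (hsub : [x, y].Sublist l) (hx : f x = y) (hy : f y = x)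
    (hxy : (y : ZMod n) = x + 1) (huniq : ∀ z ∈ l, (z : ZMod n) = y → z = y) :
    (2 : ZMod n) = 0 := by
  obtain ⟨r₁, r₂, rfl, hx₁, hy₂⟩ := List.cons_sublist_iff.1 hsub
  obtain ⟨s, t, rfl⟩ := List.append_of_mem hx₁
  rw [List.singleton_sublist] at hy₂
  obtain ⟨z, l', hz⟩ : ∃ z l', t ++ r₂ = z :: l' :=
    List.exists_cons_of_ne_nil fun h => by simp [(List.append_eq_nil_iff.1 h).2] at hy₂
  unfold CyclicChain at h hf
  rw [List.append_assoc, List.cons_append, hz] at h hf huniq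
  rw [List.map_append, List.map_cons, List.map_cons] at hf
  have h' := (List.isChain_cons_cons.1 (List.isChain_append.1 h).2.1).1
  have hf' := (List.isChain_cons_cons.1 (List.isChain_append.1 hf).2.1).1
  have hzy : z = y := huniq z (by simp) (h'.trans hxy.symm)
  rw [hzy, hx, hy] at hf'
  rw [hxy] at hf'
  linear_combination -hf'

/-- A letter whose cyclic predecessor is missing can only start the chain. -/
theorem CyclicChain.eq_cons_of_forall {l : List ℤ} {y : ℤ} (h : CyclicChain n l) (hy : y ∈ l)
    (hpred : ∀ z ∈ l, (y : ZMod n) ≠ z + 1) : ∃ t, l = y :: t := by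
  obtain ⟨s, t, rfl⟩ := List.append_of_mem hy
  rcases List.eq_nil_or_concat s with rfl | ⟨s, z, rfl⟩
  · exact ⟨t, rfl⟩
  · unfold CyclicChain at h
    rw [List.concat_eq_append] at *
    exact absurd ((List.isChain_append.1 h).2.2 z (by simp) y (by simp)) (hpred z (by simp))

theorem pair_sublist_of_lt {α : Type*} (l : List α) {j k : ℕ} (hjk : j < k) (hk : k < l.length) :
    [l[j], l[k]].Sublist l := by
  refine List.cons_sublist_iff.2 ⟨l.take k, l.drop k, (List.take_append_drop k l).symm, ?_, ?_⟩
  · rw [List.mem_take_iff_getElem]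
    exact ⟨j, by omega, rfl⟩
  · rw [List.singleton_sublist, List.mem_drop_iff_getElem]
    exact ⟨0, by omega, by simp⟩

end Words

/-! ### One-line notation and the ascents that stay among signed arc permutations. -/

section OneLine

variable {n : ℕ}

theorem length_oneLine (u : hyperoctahedralGroup n) : (oneLine u).length = n := by
  simp [oneLine]

theorem getElem_oneLine (u : hyperoctahedralGroup n) (j : ℕ) (hj : j < (oneLine u).length) :
    (oneLine u)[j] = u.1 (PM.pos ⟨j, by simpa [oneLine] using hj⟩) := by
  simp [oneLine]

theorem bounds_of_mem_oneLine {u : hyperoctahedralGroup n} {x : ℤ} (hx : x ∈ oneLine u) :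
    -(n : ℤ) ≤ x ∧ x ≤ n ∧ x ≠ 0 := by
  rw [oneLine, List.mem_ofFn] at hx
  obtain ⟨j, rfl⟩ := hx
  exact (u.1 (PM.pos j)).bounds

theorem coe_mem_oneLine_iff (u : hyperoctahedralGroup n) (k : PM n) :
    (k : ℤ) ∈ oneLine u ↔ 0 < (u.1⁻¹ k : ℤ) := by
  rw [oneLine, List.mem_ofFn]
  constructor
  · rintro ⟨j, hj⟩
    rw [← Subtype.ext hj, hyperoctahedral_inv_apply, PM.coe_pos]
    omega
  · intro h
    obtain ⟨j, hj | hj⟩ := (u.1⁻¹ k).eq_pos_or_eq_neg_pos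
    · exact ⟨j, by rw [← hj, hyperoctahedral_apply_inv]⟩
    · rw [hj, PM.coe_neg, PM.coe_pos] at h
      omega

theorem neg_notMem_oneLine {u : hyperoctahedralGroup n} {x : ℤ} (hx : x ∈ oneLine u) :
    -x ∉ oneLine u := by
  have hb := bounds_of_mem_oneLine hx
  have h := (coe_mem_oneLine_iff u (PM.of x hb)).1 hx
  have h' := (coe_mem_oneLine_iff u (-PM.of x hb)).not
  rw [hyperoctahedral_inv_neg, PM.coe_neg, PM.coe_neg] at h'
  exact h'.2 (by omega)

theorem nodup_oneLine (u : hyperoctahedralGroup n) : (oneLine u).Nodup := by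
  rw [oneLine, List.nodup_ofFn]
  intro i j hij
  have := congrArg Subtype.val (u.1.injective (Subtype.ext hij))
  simp only [PM.coe_pos] at this
  exact Fin.ext (by omega)

theorem oneLine_simpleB_mul (i : Fin n) (u : hyperoctahedralGroup n) :
    oneLine (simpleB n i * u) = (oneLine u).map (simpleVal i) := by
  rw [oneLine, oneLine, List.map_ofFn]
  congr 1
  ext j
  exact coe_simplePerm i _

/-- The two shuffled words are forced: they must be the subwords of positive and of negative
letters, so the existential disappears. -/
theorem mem_signedArc_iff (u : hyperoctahedralGroup n) :
    u ∈ signedArc n ↔ ArcWord n (oneLine u) := by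
  have hcong : ∀ x y : ℤ, x ≡ -y + 1 [ZMOD n] ↔ (x : ZMod n) = -y + 1 := fun x y => by
    rw [← ZMod.intCast_eq_intCast_iff]
    push_cast
    rfl
  constructor
  · rintro ⟨a, b, ha, hb, ⟨hab, hba⟩, ca, cb, hh⟩
    have hmem : ∀ x ∈ oneLine u, (x ∉ b ↔ 0 < x) ∧ (x ∉ a ↔ x < 0) := by
      intro x hx
      have h1 : x ∉ b → x ∈ a := fun h => by rw [← hab]; simp [hx, h]
      have h2 := ha x
      have h3 := hb x
      have h4 := (bounds_of_mem_oneLine hx).2.2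
      refine ⟨⟨fun h => ?_, fun h h' => ?_⟩, ⟨fun h => ?_, fun h h' => ?_⟩⟩
      · have := h2 (h1 h); omega
      · have := h3 h'; omega
      · have := h3 (not_imp_comm.1 h1 h); omega
      · have := h2 h'; omega
    have ea : posLetters (oneLine u) = a := by
      rw [← hab, posLetters]
      exact List.filter_congr fun x hx => by simp [(hmem x hx).1]
    have eb : negLetters (oneLine u) = b := by
      rw [← hba, negLetters]
      exact List.filter_congr fun x hx => by simp [(hmem x hx).2]
    unfold ArcWord
    rw [ea, eb, cyclicChain_iff, cyclicChain_iff]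
    exact ⟨ca, cb, fun x hx y hy => (hcong x y).1 (hh x hx y hy)⟩
  · rintro ⟨ca, cb, hh⟩
    refine ⟨posLetters (oneLine u), negLetters (oneLine u), fun x hx => ?_, fun x hx => ?_, ⟨?_, ?_⟩,
      (cyclicChain_iff _).1 ca, (cyclicChain_iff _).1 cb,
      fun x hx y hy => (hcong x y).2 (hh x hx y hy)⟩
    · rw [posLetters, List.mem_filter, decide_eq_true_iff] at hx
      have := bounds_of_mem_oneLine hx.1
      omega
    · rw [negLetters, List.mem_filter, decide_eq_true_iff] at hx
      have := bounds_of_mem_oneLine hx.1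
      omega
    · refine List.filter_congr fun x hx => ?_
      have := bounds_of_mem_oneLine hx
      simp only [negLetters, List.mem_filter, decide_eq_true_iff, hx, true_and, decide_eq_decide]
      omega
    · refine List.filter_congr fun x hx => ?_
      have := bounds_of_mem_oneLine hx
      simp only [posLetters, List.mem_filter, decide_eq_true_iff, hx, true_and, decide_eq_decide]
      omega

/-- Negating the letter `1` of a signed arc permutation gives one if and only if the letter is the
first or the last one. -/
theorem simpleB_zero_mul_mem_signedArc_iff (hn : 2 ≤ n) {u : hyperoctahedralGroup n}
    (hu : u ∈ signedArc n) (i j : Fin n) (hi : (i : ℕ) = 0) (hj : u.1⁻¹ (PM.pos i) = PM.pos j) :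
    simpleB n i * u ∈ signedArc n ↔ (j : ℕ) = 0 ∨ (j : ℕ) = n - 1 := by
  have hlen := length_oneLine u
  have hjl : (j : ℕ) < (oneLine u).length := by omega
  have hget : (oneLine u)[(j : ℕ)] = 1 := by
    rw [getElem_oneLine]
    have : (⟨(j : ℕ), by omega⟩ : Fin n) = j := rfl
    rw [this, ← hj, hyperoctahedral_apply_inv, PM.coe_pos, hi]
    rfl
  have hsplit : oneLine u = (oneLine u).take j ++ 1 :: (oneLine u).drop (j + 1) := by
    rw [← hget, List.getElem_cons_drop, List.take_append_drop]
  have hnd := nodup_oneLine u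
  have hone : (1 : ℤ) ∈ oneLine u := hget ▸ List.getElem_mem _
  have hneg := neg_notMem_oneLine hone
  have hne : ∀ x ∈ oneLine u, x ≠ 0 := fun x hx => (bounds_of_mem_oneLine hx).2.2
  have l₁ : ((oneLine u).take j).length = j := by rw [List.length_take]; omega
  have l₂ : ((oneLine u).drop (j + 1)).length = n - 1 - j := by rw [List.length_drop]; omega
  rw [mem_signedArc_iff] at hu ⊢
  rw [oneLine_simpleB_mul, hi]
  generalize (oneLine u).take j = w₁ at *
  generalize (oneLine u).drop (j + 1) = w₂ at *
  rw [hsplit] at hnd hneg hne hu ⊢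
  have hmap : ∀ w : List ℤ, (1 : ℤ) ∉ w → -1 ∉ w → w.map (simpleVal 0) = w := by
    intro w h h'
    conv_rhs => rw [← List.map_id w]
    refine List.map_congr_left fun x hx => ?_
    simp [simpleVal, ne_of_mem_of_not_mem hx h, ne_of_mem_of_not_mem hx h']
  have hnd' := List.nodup_middle.1 hnd
  rw [List.nodup_cons, List.mem_append, not_or] at hnd'
  simp only [List.mem_append, List.mem_cons, not_or] at hneg
  rw [List.map_append, List.map_cons, hmap w₁ hnd'.1.1 hneg.1, hmap w₂ hnd'.1.2 hneg.2.2]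
  have : simpleVal 0 1 = -1 := rfl
  rw [this, arcWord_append_neg_one hn (fun x hx => hne x (by simp [hx]))
    (fun x hx => hne x (by simp [hx])) (by omega) hu, ← List.length_eq_zero_iff,
    ← List.length_eq_zero_iff, l₁, l₂]
  omega

theorem posLetters_map_simpleVal (w : List ℤ) (i : ℕ) (hi : 1 ≤ i) :
    posLetters (w.map (simpleVal i)) = (posLetters w).map (simpleVal i) := by
  rw [posLetters, List.filter_map, posLetters]
  congr 1
  refine List.filter_congr fun x _ => decide_eq_decide.2 ?_
  unfold simpleVal
  split_ifs <;> omega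

theorem negLetters_map_simpleVal (w : List ℤ) (i : ℕ) (hi : 1 ≤ i) :
    negLetters (w.map (simpleVal i)) = (negLetters w).map (simpleVal i) := by
  rw [negLetters, List.filter_map, negLetters]
  congr 1
  refine List.filter_congr fun x _ => decide_eq_decide.2 ?_
  unfold simpleVal
  split_ifs <;> omega

theorem oneLine_pair_sublist {u : hyperoctahedralGroup n} {x y : PM n} (hx : 0 < (u.1⁻¹ x : ℤ))
    (hxy : u.1⁻¹ x < u.1⁻¹ y) : [(x : ℤ), (y : ℤ)].Sublist (oneLine u) := by
  rw [← Subtype.coe_lt_coe] at hxy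
  have hlen := length_oneLine u
  obtain ⟨j, hj | hj⟩ := (u.1⁻¹ x).eq_pos_or_eq_neg_pos
  · obtain ⟨k, hk | hk⟩ := (u.1⁻¹ y).eq_pos_or_eq_neg_pos
    · rw [hj, hk, PM.coe_pos, PM.coe_pos] at hxy
      have := pair_sublist_of_lt (oneLine u) (j := j) (k := k) (by omega) (by omega)
      rw [getElem_oneLine, getElem_oneLine] at this
      change [((u.1 (PM.pos j) : PM n) : ℤ), ((u.1 (PM.pos k) : PM n) : ℤ)].Sublist _ at this
      rwa [← hj, ← hk, hyperoctahedral_apply_inv,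
        hyperoctahedral_apply_inv] at this
    · rw [hk, PM.coe_neg, PM.coe_pos] at hxy
      omega
  · rw [hj, PM.coe_neg, PM.coe_pos] at hx
    omega

/-- For `n ≥ 3`, no ascent `i ≥ 1` of a signed arc permutation leads to a signed arc
permutation. -/
theorem simpleB_mul_notMem_signedArc (hn : 3 ≤ n) {u : hyperoctahedralGroup n}
    (hu : u ∈ signedArc n) {i : Fin n} (hi : 1 ≤ (i : ℕ)) (hasc : i ∉ Des (simpleB n) u) :
    simpleB n i * u ∉ signedArc n := by
  intro hsu
  have h1 := ZMod.one_ne_zero_of_two_le (n := n) (by omega)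
  have h2 := ZMod.two_ne_zero_of_three_le hn
  have hin := i.2
  rw [notMem_Des_simpleB] at hasc
  have hsp : (simplePerm i (PM.pos i) : ℤ) = i := by
    rw [coe_simplePerm, PM.coe_pos]
    simp [simpleVal, show (i : ℕ) ≠ 0 by omega]
  have hp := PM.coe_pos i
  generalize simplePerm i (PM.pos i) = x at *
  generalize PM.pos i = y at *
  rw [mem_signedArc_iff] at hu hsu
  rw [oneLine_simpleB_mul] at hsu
  obtain ⟨ca, cb, -⟩ := hu
  obtain ⟨ca', cb', -⟩ := hsu
  rw [posLetters_map_simpleVal _ _ hi] at ca'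
  rw [negLetters_map_simpleVal _ _ hi] at cb'
  have hbp : ∀ z ∈ posLetters (oneLine u), 0 < z ∧ z ≤ n := fun z hz => by
    rw [posLetters, List.mem_filter, decide_eq_true_iff] at hz
    exact ⟨hz.2, (bounds_of_mem_oneLine hz.1).2.1⟩
  have hbn : ∀ z ∈ negLetters (oneLine u), z < 0 ∧ -(n : ℤ) ≤ z := fun z hz => by
    rw [negLetters, List.mem_filter, decide_eq_true_iff] at hz
    exact ⟨hz.2, (bounds_of_mem_oneLine hz.1).1⟩
  have hx0 := (u.1⁻¹ x).bounds
  have hy0 := (u.1⁻¹ y).bounds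
  have hlt := hasc
  rw [← Subtype.coe_lt_coe] at hlt
  -- Both letters are positive: `i` precedes `i + 1` and `s_i` exchanges them.
  by_cases hx : 0 < (u.1⁻¹ x : ℤ)
  · have hsub := (oneLine_pair_sublist hx hasc).filter fun z => decide (0 < z)
    rw [hsp, hp] at hsub
    refine h2 (ca.two_eq_zero_of_swap (x := i) (y := i + 1) ca' ?_ ?_ ?_ (by push_cast; rfl)
      fun z hz hzy => ?_)
    · rwa [List.filter_cons_of_pos (by exact decide_eq_true (by omega)),
        List.filter_cons_of_pos (by exact decide_eq_true (by omega)), List.filter_nil] at hsub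
    · simp [simpleVal, show (i : ℕ) ≠ 0 by omega]
    · simp [simpleVal, show (i : ℕ) ≠ 0 by omega]
    · have := hbp z hz
      exact ZMod.eq_of_intCast_eq hzy (by omega) (by omega)
  -- Both letters are negative: `-(i+1)` precedes `-i`.
  by_cases hy : (u.1⁻¹ y : ℤ) < 0
  · have hlt' : u.1⁻¹ (-y) < u.1⁻¹ (-x) := by
      rwa [hyperoctahedral_inv_neg, hyperoctahedral_inv_neg, PM.neg_lt_neg_iff]
    have hy' : 0 < (u.1⁻¹ (-y) : ℤ) := by
      rw [hyperoctahedral_inv_neg, PM.coe_neg]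
      omega
    have hsub := (oneLine_pair_sublist hy' hlt').filter fun z => decide (z < 0)
    rw [PM.coe_neg, PM.coe_neg, hsp, hp] at hsub
    have hi0 : (i : ℕ) ≠ 0 := by omega
    refine h2 (cb.two_eq_zero_of_swap (x := -(i + 1)) (y := -i) cb' ?_ ?_ ?_ (by push_cast; ring)
      fun z hz hzy => ?_)
    · rwa [List.filter_cons_of_pos (by exact decide_eq_true (by omega)), List.filter_cons_of_pos (by exact decide_eq_true (by omega)),
        List.filter_nil] at hsub
    · simp only [simpleVal, hi0, if_false]
      split_ifs <;> omega
    · simp only [simpleVal, hi0, if_false]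
      split_ifs <;> omega
    · have := hbn z hz
      exact ZMod.eq_of_intCast_eq hzy (by omega) (by omega)
  -- Mixed case: `-i` and `i + 1` occur, so `i` and `-(i+1)` do not. These are the cyclic
  -- predecessors of `i + 1` and `-i`, which therefore head their chains. A second letter in either
  -- chain would be fixed by `s_i` and would have to follow both the old and the new head, so each
  -- chain has one letter and `n = 2`.
  have hyw : (i : ℤ) + 1 ∈ oneLine u := hp ▸ (coe_mem_oneLine_iff u y).2 (by omega)
  have hxw : -(i : ℤ) ∈ oneLine u := by
    have := coe_mem_oneLine_iff u (-x)
    rw [hyperoctahedral_inv_neg, PM.coe_neg, PM.coe_neg, hsp] at this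
    exact this.2 (by omega)
  have hyw' := neg_notMem_oneLine hyw
  have hxw' := neg_notMem_oneLine hxw
  have hlen := length_posLetters_add_length_negLetters (w := oneLine u)
    fun z hz => (bounds_of_mem_oneLine hz).2.2
  rw [length_oneLine] at hlen
  obtain ⟨a, ha⟩ := ca.eq_cons_of_forall (y := i + 1)
    (by rw [posLetters, List.mem_filter]; exact ⟨hyw, decide_eq_true (by omega)⟩) fun z hz hzi => hxw' (by
      have hb := hbp z hz
      have : z = i := ZMod.eq_of_intCast_eq (by push_cast at hzi ⊢; linear_combination -hzi)
        (by omega) (by omega)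
      rw [neg_neg, ← this]
      exact (List.mem_filter.1 hz).1)
  obtain ⟨b, hb⟩ := cb.eq_cons_of_forall (y := -i)
    (by rw [negLetters, List.mem_filter]; exact ⟨hxw, decide_eq_true (by omega)⟩) fun z hz hzi => hyw' (by
      have hb := hbn z hz
      have : z = -(i + 1) := ZMod.eq_of_intCast_eq (by push_cast at hzi ⊢; linear_combination -hzi)
        (by omega) (by omega)
      rw [← this]
      exact (List.mem_filter.1 hz).1)
  rw [ha] at ca ca' hlen hbp
  rw [hb] at cb cb' hlen hbn
  have hi0 : (i : ℕ) ≠ 0 := by omega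
  have ea : a = [] := by
    rcases a with - | ⟨z, a⟩
    · rfl
    exfalso
    have e1 := (List.isChain_cons_cons.1 ca).1
    have e2 := (List.isChain_cons_cons.1 ca').1
    have hz := hbp z (by simp)
    have hz1 : z ≠ i := fun h => h2 (by rw [h] at e1; push_cast at e1; linear_combination -e1)
    have hz2 : z ≠ i + 1 := fun h => h1 (by rw [h] at e1; push_cast at e1; linear_combination -e1)
    have e3 : simpleVal i z = z := by
      simp only [simpleVal, hi0, if_false]
      split_ifs <;> omega
    have e4 : simpleVal i ((i : ℤ) + 1) = i := by simp [simpleVal, hi0]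
    rw [e3, e4] at e2
    push_cast at e1 e2
    exact h1 (by linear_combination e2 - e1)
  have eb : b = [] := by
    rcases b with - | ⟨z, b⟩
    · rfl
    exfalso
    have e1 := (List.isChain_cons_cons.1 cb).1
    have e2 := (List.isChain_cons_cons.1 cb').1
    have hz := hbn z (by simp)
    have hz1 : z ≠ -i := fun h => h1 (by rw [h] at e1; push_cast at e1; linear_combination -e1)
    have hz2 : z ≠ -(i + 1) := fun h =>
      h2 (by rw [h] at e1; push_cast at e1; linear_combination -e1)
    have e3 : simpleVal i z = z := by
      simp only [simpleVal, hi0, if_false]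
      split_ifs <;> omega
    have e4 : simpleVal i (-(i : ℤ)) = -(i + 1) := by
      simp only [simpleVal, hi0, if_false]
      split_ifs <;> omega
    rw [e3, e4] at e2
    push_cast at e1 e2
    exact h1 (by linear_combination e2 - e1)
  rw [ea, eb] at hlen
  simp at hlen
  omega

end OneLine

/-! ### Ascent-compatibility. -/

section AscentCompatible

variable {n : ℕ}

theorem signedArc_eq_univ (hn : n ≤ 2) : signedArc n = Set.univ := by
  refine Set.eq_univ_of_forall fun u => (mem_signedArc_iff u).2 ?_
  have hlen := length_oneLine u
  have hb : ∀ x ∈ oneLine u, _ := fun x hx => bounds_of_mem_oneLine hx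
  have hneg : ∀ x ∈ oneLine u, _ := fun x hx => neg_notMem_oneLine hx
  have hnd := nodup_oneLine u
  generalize oneLine u = w at *
  interval_cases n
  · rw [List.length_eq_zero_iff] at hlen
    simp [hlen, ArcWord, CyclicChain, posLetters, negLetters]
  · obtain ⟨x, rfl⟩ := List.length_eq_one_iff.1 hlen
    have := hb x (by simp)
    rcases lt_or_gt_of_ne this.2.2 with h | h <;>
    simp [ArcWord, CyclicChain, posLetters, negLetters, h, h.not_gt]
  · obtain ⟨x, y, rfl⟩ := List.length_eq_two.1 hlen
    have hx := hb x (by simp)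
    have hy := hb y (by simp)
    have hxy := hneg x (by simp)
    simp only [List.mem_cons, List.not_mem_nil, or_false, not_or] at hxy
    simp only [List.nodup_cons, List.mem_singleton] at hnd
    obtain ⟨x₁, x₂, x₃⟩ := hx
    obtain ⟨y₁, y₂, y₃⟩ := hy
    push_cast at x₁ x₂ y₁ y₂
    interval_cases x <;> interval_cases y <;>
    first
    | omega
    | (simp [ArcWord, CyclicChain, posLetters, negLetters]; try decide)

theorem simplePerm_zero_apply_pos {i : Fin n} (hi : (i : ℕ) = 0) :
    simplePerm i (PM.pos i) = -PM.pos i := by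
  apply Subtype.ext
  rw [coe_simplePerm, PM.coe_neg, PM.coe_pos, hi]
  rfl

theorem zero_notMem_Des_iff {i : Fin n} (hi : (i : ℕ) = 0) (u : hyperoctahedralGroup n) :
    i ∉ Des (simpleB n) u ↔ 0 < (u.1⁻¹ (PM.pos i) : ℤ) := by
  rw [notMem_Des_simpleB, simplePerm_zero_apply_pos hi, hyperoctahedral_inv_neg,
    ← Subtype.coe_lt_coe, PM.coe_neg]
  omega

theorem ascentCompatible_signedArc : AscentCompatible (simpleB n) (signedArc n) := by
  rcases le_or_gt n 2 with hn | hn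
  · rw [signedArc_eq_univ hn]
    exact fun _ _ _ _ _ _ _ => Iff.rfl
  suffices H : ∀ u ∈ signedArc n, ∀ v ∈ signedArc n, ∀ i j, Aligned (simpleB n) u v i j →
      simpleB n i * u ∈ signedArc n → simpleB n j * v ∈ signedArc n from
    fun u hu v hv i j h => ⟨H u hu v hv i j h, H v hv u hu j i ⟨h.2.1, h.1, h.2.2.symm⟩⟩
  rintro u hu v hv i j ⟨hui, hvj, huv⟩ hmem
  have hi : (i : ℕ) = 0 := by
    by_contra hi
    exact simpleB_mul_notMem_signedArc hn hu (by omega) hui hmem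
  set k := u.1⁻¹ (PM.pos i) with hk
  -- The common reflection negates `k = u⁻¹(1)`, so `s_j` negates `v(k)`. Among simple generators
  -- only `s_0` negates anything, and only `±1`.
  have hneg : simplePerm j (v.1 k) = -v.1 k := by
    have h : v * (u⁻¹ * simpleB n i * u) = simpleB n j * v := by
      rw [huv]
      group
    have h' := DFunLike.congr_fun (congrArg Subtype.val h) k
    change v.1 (u.1⁻¹ (simplePerm i (u.1 k))) = simplePerm j (v.1 k) at h'
    rw [← h', hk, hyperoctahedral_apply_inv, simplePerm_zero_apply_pos hi,
      hyperoctahedral_inv_neg, v.2]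
  have hneg' := congrArg Subtype.val hneg
  rw [coe_simplePerm, PM.coe_neg] at hneg'
  have hv0 := (v.1 k).bounds
  have hj : (j : ℕ) = 0 := by
    unfold simpleVal at hneg'
    split_ifs at hneg' <;> omega
  have hij : i = j := Fin.ext (by omega)
  subst hij
  rw [zero_notMem_Des_iff hi] at hui hvj
  have hvk : v.1⁻¹ (PM.pos i) = k := by
    have h1 : v.1 k = PM.pos i ∨ v.1 k = -PM.pos i := by
      simp only [Subtype.ext_iff, PM.coe_neg, PM.coe_pos]
      simp only [simpleVal, hi, if_true] at hneg' ⊢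
      split_ifs at hneg' <;> omega
    rcases h1 with h | h
    · rw [← h, hyperoctahedral_inv_apply]
    -- Here `v⁻¹(1) = -k`, and `0` cannot be an ascent of both `u` and `v`.
    · have h2 : v.1⁻¹ (-PM.pos i) = k := by rw [← h, hyperoctahedral_inv_apply]
      rw [hyperoctahedral_inv_neg] at h2
      rw [← hk, ← h2, PM.coe_neg] at hui
      omega
  obtain ⟨p, hp | hp⟩ := k.eq_pos_or_eq_neg_pos
  · rw [simpleB_zero_mul_mem_signedArc_iff (by omega) hv i p hi (hvk.trans hp)]
    rwa [simpleB_zero_mul_mem_signedArc_iff (by omega) hu i p hi (hk.symm.trans hp)] at hmem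
  · rw [← hk, hp, PM.coe_neg, PM.coe_pos] at hui
    omega

end AscentCompatible

/-! ### Failure of convexity. -/

section NotConvex

variable {n : ℕ}

/-- The word `s_{k-1} ⋯ s_1 s_0`. -/
def descendingWord (n : ℕ) : ℕ → List (Fin n)
  | 0 => []
  | k + 1 => if h : k < n then ⟨k, h⟩ :: descendingWord n k else descendingWord n k

/-- The element `s_{k-1} ⋯ s_1 s_0`. -/
def descendingProd (n k : ℕ) : hyperoctahedralGroup n := ((descendingWord n k).map (simpleB n)).prod

theorem descendingProd_succ {k : ℕ} (hk : k < n) :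
    descendingProd n (k + 1) = simpleB n ⟨k, hk⟩ * descendingProd n k := by
  simp [descendingProd, descendingWord, hk]

theorem length_descendingWord {k : ℕ} (hk : k ≤ n) : (descendingWord n k).length = k := by
  induction k with
  | zero => rfl
  | succ k ih => rw [descendingWord, dif_pos (by omega), List.length_cons, ih (by omega)]

theorem descendingWord_suffix {m k : ℕ} (hmk : m ≤ k) :
    descendingWord n m <:+ descendingWord n k := by
  induction k, hmk using Nat.le_induction with
  | base => exact List.suffix_refl _
  | succ k _ ih =>
    rw [descendingWord]
    split_ifs
    · exact ih.trans (List.suffix_cons _ _)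
    · exact ih

theorem coe_descendingProd_apply {k : ℕ} (hk : k < n) (j : Fin n) :
    ((descendingProd n (k + 1)).1 (PM.pos j) : ℤ) =
      if (j : ℕ) = 0 then -((k : ℤ) + 1) else if (j : ℕ) < k + 1 then (j : ℤ) else j + 1 := by
  induction k with
  | zero =>
    rw [descendingProd_succ hk, simpleB_mul_apply, coe_simplePerm]
    change simpleVal 0 ((PM.pos j : PM n) : ℤ) = _
    rw [PM.coe_pos]
    simp only [simpleVal, if_true]
    push_cast
    split_ifs <;> omega
  | succ k ih =>
    rw [descendingProd_succ hk, simpleB_mul_apply, coe_simplePerm, ih (by omega)]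
    simp only [simpleVal]
    push_cast
    split_ifs <;> omega

/-- Each letter prepended to the word is an ascent, which makes the whole word, and hence all its
suffixes of this form, reduced. -/
theorem notMem_Des_descendingProd {k : ℕ} (hk : k < n) :
    (⟨k, hk⟩ : Fin n) ∉ Des (simpleB n) (descendingProd n k) := by
  rcases k with - | k
  · rw [zero_notMem_Des_iff rfl]
    change (0 : ℤ) < ((PM.pos ⟨0, hk⟩ : PM n) : ℤ)
    rw [PM.coe_pos]
    omega
  rw [notMem_Des_simpleB]
  have h1 : (descendingProd n (k + 1)).1 (-PM.pos ⟨0, by omega⟩) =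
      simplePerm ⟨k + 1, hk⟩ (PM.pos ⟨k + 1, hk⟩) := by
    apply Subtype.ext
    rw [(descendingProd n (k + 1)).2, PM.coe_neg, coe_descendingProd_apply (by omega),
      coe_simplePerm, PM.coe_pos]
    simp [simpleVal]
  have h2 : (descendingProd n (k + 1)).1 (PM.pos ⟨k + 1, hk⟩) = PM.pos ⟨k + 1, hk⟩ := by
    apply Subtype.ext
    rw [coe_descendingProd_apply (by omega), PM.coe_pos]
    simp
  have h3 : (descendingProd n (k + 1)).1⁻¹ (PM.pos ⟨k + 1, hk⟩) = PM.pos ⟨k + 1, hk⟩ :=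
    (Equiv.Perm.inv_eq_iff_eq).2 h2.symm
  rw [← h1, hyperoctahedral_inv_apply, h3, ← Subtype.coe_lt_coe, PM.coe_neg, PM.coe_pos, PM.coe_pos]
  push_cast
  omega

theorem wordLength_descendingProd {k : ℕ} (hk : k ≤ n) :
    wordLength (simpleB n) (descendingProd n k) = k := by
  induction k with
  | zero =>
    rw [wordLength_simpleB]
    change invWeight 1 / 2 = 0
    rw [invWeight_one]
  | succ k ih =>
    rw [descendingProd_succ (by omega), wordLength_simpleB_mul (notMem_Des_descendingProd _),
      ih (by omega)]

theorem isReducedWord_descendingWord {k : ℕ} (hk : k ≤ n) :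
    IsReducedWord (simpleB n) (descendingWord n k) (descendingProd n k) :=
  ⟨rfl, by rw [length_descendingWord hk, wordLength_descendingProd hk]⟩

theorem leftWeakLE_descendingProd {m k : ℕ} (hmk : m ≤ k) (hk : k ≤ n) :
    LeftWeakLE (simpleB n) (descendingProd n m) (descendingProd n k) := by
  obtain ⟨l, hl⟩ := descendingWord_suffix (n := n) hmk
  exact ⟨l, descendingWord n m, hl ▸ isReducedWord_descendingWord hk,
    isReducedWord_descendingWord (hmk.trans hk)⟩

theorem posLetters_ofFn (m : ℕ) : posLetters (List.ofFn fun j : Fin m => (j : ℤ) + 1) =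
    List.ofFn fun j : Fin m => (j : ℤ) + 1 := by
  refine List.filter_eq_self.2 fun x hx => ?_
  obtain ⟨j, rfl⟩ := List.mem_ofFn.1 hx
  exact decide_eq_true (by omega)

theorem negLetters_ofFn (m : ℕ) : negLetters (List.ofFn fun j : Fin m => (j : ℤ) + 1) = [] := by
  refine List.filter_eq_nil_iff.2 fun x hx => ?_
  obtain ⟨j, rfl⟩ := List.mem_ofFn.1 hx
  simp only [decide_eq_true_iff]
  omega

theorem cyclicChain_ofFn (m : ℕ) : CyclicChain n (List.ofFn fun j : Fin m => (j : ℤ) + 1) := by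
  unfold CyclicChain
  rw [List.isChain_iff_getElem]
  intro i hi
  simp

theorem one_mem_signedArc : (1 : hyperoctahedralGroup n) ∈ signedArc n := by
  rw [mem_signedArc_iff]
  have : oneLine (1 : hyperoctahedralGroup n) = List.ofFn fun j : Fin n => (j : ℤ) + 1 := rfl
  rw [this]
  refine ⟨?_, ?_, ?_⟩
  · rw [posLetters_ofFn]
    exact cyclicChain_ofFn n
  · rw [negLetters_ofFn]
    exact List.isChain_nil
  · rw [negLetters_ofFn]
    simp

/-- The one-line notation is `-n, 1, 2, …, n-1`, and `1 ≡ n + 1` modulo `n`. -/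
theorem descendingProd_self_mem_signedArc (hn : 0 < n) : descendingProd n n ∈ signedArc n := by
  rw [mem_signedArc_iff]
  obtain ⟨m, rfl⟩ : ∃ m, n = m + 1 := ⟨n - 1, by omega⟩
  have : oneLine (descendingProd (m + 1) (m + 1)) =
      -((m : ℤ) + 1) :: List.ofFn fun j : Fin m => (j : ℤ) + 1 := by
    rw [oneLine, List.ofFn_succ]
    congr 1
    · rw [coe_descendingProd_apply (by omega)]
      simp
    · congr 1
      ext j
      rw [coe_descendingProd_apply (by omega)]
      simp
  have h1 : posLetters (-((m : ℤ) + 1) :: List.ofFn fun j : Fin m => (j : ℤ) + 1) =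
      List.ofFn fun j : Fin m => (j : ℤ) + 1 := by
    conv_rhs => rw [← posLetters_ofFn]
    exact List.filter_cons_of_neg (by simp only [decide_eq_true_iff]; omega)
  have h2 : negLetters (-((m : ℤ) + 1) :: List.ofFn fun j : Fin m => (j : ℤ) + 1) =
      [-((m : ℤ) + 1)] := by
    rw [← negLetters_ofFn m]
    exact List.filter_cons_of_pos (decide_eq_true (by omega))
  unfold ArcWord
  rw [this, h1, h2]
  refine ⟨cyclicChain_ofFn m, List.isChain_singleton _, ?_⟩
  intro x hx y hy
  rcases m with - | m
  · simp at hx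
  rw [List.ofFn_succ] at hx
  simp at hx hy
  subst hx hy
  have := ZMod.natCast_self (m + 1 + 1)
  push_cast at this ⊢
  linear_combination -this

/-- From `1`, negating the first letter `1` stays inside, giving `s_0`; then the ascent `1` leaves
the set at `s_1 s_0`, although the chain returns to it at `s_{n-1} ⋯ s_1 s_0`. -/
theorem not_leftWeakConvex_signedArc (hn : 3 ≤ n) :
    ¬ LeftWeakConvex (simpleB n) (signedArc n) := by
  intro h
  have h1 : descendingProd n 1 ∈ signedArc n := by
    rw [descendingProd_succ (by omega : 0 < n)]
    exact (simpleB_zero_mul_mem_signedArc_iff (by omega) one_mem_signedArc ⟨0, by omega⟩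
      ⟨0, by omega⟩ rfl rfl).2 (Or.inl rfl)
  have h2 : descendingProd n 2 ∉ signedArc n := by
    rw [descendingProd_succ (by omega : 1 < n)]
    exact simpleB_mul_notMem_signedArc hn h1 le_rfl (notMem_Des_descendingProd _)
  exact h2 (h _ one_mem_signedArc _ (descendingProd_self_mem_signedArc (by omega))
    (leftWeakLE_descendingProd (Nat.zero_le n) le_rfl) _
    (leftWeakLE_descendingProd (Nat.zero_le 2) (by omega))
    (leftWeakLE_descendingProd (by omega) le_rfl))

end NotConvex

/-! ### The operators `π_i` and the 0-Hecke relations. -/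

theorem Finsupp.end_ext_single {X : Type*} {f g : Module.End ℂ (X →₀ ℂ)}
    (h : ∀ x, f (Finsupp.single x 1) = g (Finsupp.single x 1)) : f = g :=
  Finsupp.lhom_ext' fun x => LinearMap.ext_ring (h x)

section Operators

variable {W ι : Type*} [Group W] {s : ι → W} {X : Set W} {i : ι}

theorem piOp_single_of_mem_Des {x : X} (h : i ∈ Des s (x : W)) :
    piOp s X i (Finsupp.single x 1) = -Finsupp.single x 1 := by
  simp [piOp, h]

theorem piOp_single_of_mul_mem {x : X} (h : i ∉ Des s (x : W)) (hX : s i * (x : W) ∈ X) :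
    piOp s X i (Finsupp.single x 1) = Finsupp.single ⟨s i * x, hX⟩ 1 := by
  simp [piOp, h, hX]

theorem piOp_single_of_mul_notMem {x : X} (h : i ∉ Des s (x : W)) (hX : s i * (x : W) ∉ X) :
    piOp s X i (Finsupp.single x 1) = 0 := by
  simp [piOp, h, hX]

end Operators

section HeckeAction

variable {n : ℕ}

theorem mem_Des_simpleB_mul_self {i : Fin n} {w : hyperoctahedralGroup n}
    (h : i ∉ Des (simpleB n) w) : i ∈ Des (simpleB n) (simpleB n i * w) := by
  rw [notMem_Des_simpleB] at h
  rwa [mem_Des_simpleB, simpleB_mul_inv_apply, simpleB_mul_inv_apply, simplePerm_simplePerm]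

theorem piOp_mul_self (X : Set (hyperoctahedralGroup n)) (i : Fin n) :
    piOp (simpleB n) X i * piOp (simpleB n) X i = -piOp (simpleB n) X i := by
  refine Finsupp.end_ext_single fun x => ?_
  simp only [Module.End.mul_apply, LinearMap.neg_apply]
  by_cases h : i ∈ Des (simpleB n) (x : hyperoctahedralGroup n)
  · simp only [piOp_single_of_mem_Des h, map_neg]
  by_cases hX : simpleB n i * (x : hyperoctahedralGroup n) ∈ X
  · rw [piOp_single_of_mul_mem h hX]
    exact piOp_single_of_mem_Des (mem_Des_simpleB_mul_self h)
  · simp only [piOp_single_of_mul_notMem h hX, map_zero, neg_zero]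

/-- The eigenvalue of `π_i` on a basis vector that is not raised. -/
def diagEigenvalue (i : Fin n) (w : hyperoctahedralGroup n) : ℂ :=
  open Classical in if i ∈ Des (simpleB n) w then -1 else 0

theorem diagEigenvalue_mul_self (i : Fin n) (w : hyperoctahedralGroup n) :
    diagEigenvalue i w * diagEigenvalue i w = -diagEigenvalue i w := by
  unfold diagEigenvalue
  split_ifs <;> norm_num

theorem piOp_signedArc_single (hn : 3 ≤ n) {i : Fin n} (hi : 1 ≤ (i : ℕ)) (x : signedArc n) :
    piOp (simpleB n) (signedArc n) i (Finsupp.single x 1) =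
      diagEigenvalue i (x : hyperoctahedralGroup n) • Finsupp.single x 1 := by
  unfold diagEigenvalue
  split_ifs with h
  · rw [piOp_single_of_mem_Des h, neg_one_smul]
  · rw [piOp_single_of_mul_notMem h (simpleB_mul_notMem_signedArc hn x.2 hi h), zero_smul]

theorem simplePerm_succ_apply_pos {i j : Fin n} (h : (j : ℕ) = i + 1) :
    simplePerm j (PM.pos j) = PM.pos i := by
  apply Subtype.ext
  rw [coe_simplePerm, PM.coe_pos, PM.coe_pos, h]
  simp [simpleVal]

theorem mem_Des_succ_iff {i j : Fin n} (h : (j : ℕ) = i + 1) (w : hyperoctahedralGroup n) :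
    j ∈ Des (simpleB n) w ↔ (w.1⁻¹ (PM.pos j) : ℤ) < w.1⁻¹ (PM.pos i) := by
  rw [mem_Des_simpleB, simplePerm_succ_apply_pos h, Subtype.coe_lt_coe]

theorem mem_Des_zero_iff {i : Fin n} (hi : (i : ℕ) = 0) (w : hyperoctahedralGroup n) :
    i ∈ Des (simpleB n) w ↔ (w.1⁻¹ (PM.pos i) : ℤ) < 0 := by
  rw [← not_iff_not, zero_notMem_Des_iff hi]
  have := (w.1⁻¹ (PM.pos i)).bounds
  omega

theorem simplePerm_zero_apply_pos_of_one_le {i j : Fin n} (hi : (i : ℕ) = 0)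
    (hj : 1 ≤ (j : ℕ)) : simplePerm i (PM.pos j) = PM.pos j := by
  apply Subtype.ext
  rw [coe_simplePerm, PM.coe_pos]
  unfold simpleVal
  split_ifs <;> omega

/-- The descent `j ≥ 2` only concerns the letters `j` and `j + 1`, which `s_0` fixes. Thus `π_j` has
the same eigenvalue at `x` and `s_0 x`, as commutation with `π_0` requires. -/
theorem mem_Des_simpleB_zero_mul_iff {i j : Fin n} (hi : (i : ℕ) = 0) (hj : 2 ≤ (j : ℕ))
    (w : hyperoctahedralGroup n) :
    j ∈ Des (simpleB n) (simpleB n i * w) ↔ j ∈ Des (simpleB n) w := by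
  have hj' := j.2
  rw [mem_Des_succ_iff (i := ⟨j - 1, by omega⟩) (by simp; omega),
    mem_Des_succ_iff (i := ⟨j - 1, by omega⟩) (by simp; omega), simpleB_mul_inv_apply,
    simpleB_mul_inv_apply, simplePerm_zero_apply_pos_of_one_le hi (by omega),
    simplePerm_zero_apply_pos_of_one_le hi (by simp; omega)]

theorem piOp_signedArc_comm {i j : Fin n} (hij : (i : ℕ) + 2 ≤ j) :
    piOp (simpleB n) (signedArc n) i * piOp (simpleB n) (signedArc n) j =
      piOp (simpleB n) (signedArc n) j * piOp (simpleB n) (signedArc n) i := by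
  have hn : 3 ≤ n := by have := j.2; omega
  refine Finsupp.end_ext_single fun x => ?_
  simp only [Module.End.mul_apply]
  rw [piOp_signedArc_single hn (by omega), map_smul]
  rcases Nat.eq_zero_or_pos (i : ℕ) with hi | hi
  · by_cases h : i ∈ Des (simpleB n) (x : hyperoctahedralGroup n)
    · rw [piOp_single_of_mem_Des h, map_neg, piOp_signedArc_single hn (by omega), smul_neg]
    by_cases hX : simpleB n i * (x : hyperoctahedralGroup n) ∈ signedArc n
    · rw [piOp_single_of_mul_mem h hX, piOp_signedArc_single hn (by omega)]
      congr 1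
      classical
      exact if_congr (mem_Des_simpleB_zero_mul_iff hi (by omega) _).symm rfl rfl
    · rw [piOp_single_of_mul_notMem h hX, map_zero, smul_zero]
  · rw [piOp_signedArc_single hn hi, map_smul, piOp_signedArc_single hn (by omega), smul_comm]

/-- Both operators are diagonal with eigenvalues satisfying `d² = -d`, so both sides act by `-d_i
d_j`. -/
theorem piOp_signedArc_braid {i j : Fin n} (hi : 1 ≤ (i : ℕ)) (hij : (j : ℕ) = i + 1) :
    piOp (simpleB n) (signedArc n) i * piOp (simpleB n) (signedArc n) j *
        piOp (simpleB n) (signedArc n) i =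
      piOp (simpleB n) (signedArc n) j * piOp (simpleB n) (signedArc n) i *
        piOp (simpleB n) (signedArc n) j := by
  have hn : 3 ≤ n := by have := j.2; omega
  refine Finsupp.end_ext_single fun x => ?_
  simp only [Module.End.mul_apply, map_smul, piOp_signedArc_single hn hi,
    piOp_signedArc_single hn (show 1 ≤ (j : ℕ) by omega), smul_smul]
  congr 1
  have h₁ := diagEigenvalue_mul_self i (x : hyperoctahedralGroup n)
  have h₂ := diagEigenvalue_mul_self j (x : hyperoctahedralGroup n)
  linear_combination diagEigenvalue j (x : hyperoctahedralGroup n) * h₁ -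
    diagEigenvalue i (x : hyperoctahedralGroup n) * h₂

theorem simpleB_braid₄ {i j : Fin n} (hi : (i : ℕ) = 0) (hj : (j : ℕ) = 1)
    (w : hyperoctahedralGroup n) :
    simpleB n i * (simpleB n j * (simpleB n i * (simpleB n j * w))) =
      simpleB n j * (simpleB n i * (simpleB n j * (simpleB n i * w))) := by
  refine Subtype.ext (Equiv.ext fun k => Subtype.ext ?_)
  simp only [simpleB_mul_apply, coe_simplePerm, hi, hj]
  generalize ((w.1 k : PM n) : ℤ) = z
  by_cases h : z = 1 ∨ z = -1 ∨ z = 2 ∨ z = -2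
  · rcases h with rfl | rfl | rfl | rfl <;> simp [simpleVal]
  · have : ∀ m : ℕ, m = 0 ∨ m = 1 → simpleVal m z = z := by
      rintro m (rfl | rfl) <;> simp only [simpleVal] <;> split_ifs <;> omega
    simp only [this 0 (by simp), this 1 (by simp)]

/-- The 0-Hecke relation of length four on the whole group. -/
theorem piOp_univ_braid₄ {X : Set (hyperoctahedralGroup n)} (hX : X = Set.univ) {i j : Fin n}
    (hi : (i : ℕ) = 0) (hj : (j : ℕ) = 1) :
    piOp (simpleB n) X i * piOp (simpleB n) X j * piOp (simpleB n) X i * piOp (simpleB n) X j =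
      piOp (simpleB n) X j * piOp (simpleB n) X i * piOp (simpleB n) X j *
        piOp (simpleB n) X i := by
  classical
  subst hX
  let e (w : hyperoctahedralGroup n) : (Set.univ : Set (hyperoctahedralGroup n)) →₀ ℂ :=
    Finsupp.single ⟨w, Set.mem_univ w⟩ 1
  have hπ : ∀ k w, piOp (simpleB n) Set.univ k (e w) =
      if k ∈ Des (simpleB n) w then -e w else e (simpleB n k * w) := by
    intro k w
    split_ifs with h
    · exact piOp_single_of_mem_Des (x := ⟨w, Set.mem_univ w⟩) h
    · exact piOp_single_of_mul_mem (x := ⟨w, Set.mem_univ w⟩) h (Set.mem_univ _)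
  refine Finsupp.end_ext_single fun x => ?_
  obtain ⟨w, -⟩ := x
  change (_ * _ : Module.End ℂ _) (e w) = (_ * _ : Module.End ℂ _) (e w)
  simp only [Module.End.mul_apply]
  have hij : (j : ℕ) = i + 1 := by omega
  have c₁ : simplePerm i (PM.pos i) = -PM.pos i := simplePerm_zero_apply_pos hi
  have c₂ : simplePerm i (PM.pos j) = PM.pos j :=
    simplePerm_zero_apply_pos_of_one_le hi (by omega)
  have c₃ : simplePerm j (PM.pos j) = PM.pos i := simplePerm_succ_apply_pos hij
  have c₄ : simplePerm j (PM.pos i) = PM.pos j := by rw [← c₃, simplePerm_simplePerm]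
  have h₀ : ∀ w : hyperoctahedralGroup n, _ := fun w => mem_Des_zero_iff hi w
  have h₁ : ∀ w : hyperoctahedralGroup n, _ := fun w => mem_Des_succ_iff hij w
  have hA := (w.1⁻¹ (PM.pos i)).bounds
  have hB := (w.1⁻¹ (PM.pos j)).bounds
  have hAB : (w.1⁻¹ (PM.pos i) : ℤ) ≠ w.1⁻¹ (PM.pos j) := fun h => by
    have := congrArg Subtype.val (w.1⁻¹.injective (Subtype.ext h))
    rw [PM.coe_pos, PM.coe_pos] at this
    omega
  have hAB' : -(w.1⁻¹ (PM.pos i) : ℤ) ≠ w.1⁻¹ (PM.pos j) := fun h => by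
    rw [← PM.coe_neg, ← hyperoctahedral_inv_neg] at h
    have := congrArg Subtype.val (w.1⁻¹.injective (Subtype.ext h))
    rw [PM.coe_neg, PM.coe_pos, PM.coe_pos] at this
    omega
  have hb := simpleB_braid₄ hi hj w
  -- With `A = w⁻¹(1)` and `B = w⁻¹(2)`, every descent test met on either side compares `±A`, `±B`
  -- and `0`. The signs of `A`, `B`, `B - A` and `A + B` decide them all; inconsistent sign patterns
  -- are discarded.
  obtain ⟨A, eA⟩ : ∃ A, (w.1⁻¹ (PM.pos i) : ℤ) = A := ⟨_, rfl⟩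
  obtain ⟨B, eB⟩ : ∃ B, (w.1⁻¹ (PM.pos j) : ℤ) = B := ⟨_, rfl⟩
  rw [eA] at hA hAB hAB'
  rw [eB] at hB hAB hAB'
  have r₁ : A < B ↔ ¬B < A := by omega
  have r₂ : A < -B ↔ A + B < 0 := by omega
  have r₄ : B < -A ↔ A + B < 0 := by omega
  have r₅ : -A < B ↔ ¬A + B < 0 := by omega
  have r₆ : -A < 0 ↔ ¬A < 0 := by omega
  have r₇ : -B < 0 ↔ ¬B < 0 := by omega
  have r₈ : -A < -B ↔ B < A := by omega
  by_cases p₁ : A < 0 <;> by_cases p₂ : B < 0 <;> by_cases p₃ : B < A <;>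
  by_cases p₄ : A + B < 0 <;>
  first
  | omega
  | simp only [r₁, r₂, r₄, r₅, r₆, r₇, r₈, p₁, p₂, p₃, p₄, hπ, h₀, h₁, simpleB_mul_inv_apply,
      c₁, c₂, c₃, c₄, hyperoctahedral_inv_neg, PM.coe_neg, eA, eB,
      if_true, if_false, not_false_eq_true, map_neg, hb, neg_neg]

theorem piOp_signedArc_braid₄ {i j : Fin n} (hi : (i : ℕ) = 0) (hj : (j : ℕ) = 1) :
    piOp (simpleB n) (signedArc n) i * piOp (simpleB n) (signedArc n) j *
        piOp (simpleB n) (signedArc n) i * piOp (simpleB n) (signedArc n) j =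
      piOp (simpleB n) (signedArc n) j * piOp (simpleB n) (signedArc n) i *
        piOp (simpleB n) (signedArc n) j * piOp (simpleB n) (signedArc n) i := by
  rcases le_or_gt n 2 with hn | hn
  · exact piOp_univ_braid₄ (signedArc_eq_univ hn) hi hj
  have hj1 : 1 ≤ (j : ℕ) := by omega
  refine Finsupp.end_ext_single fun x => ?_
  simp only [Module.End.mul_apply]
  rw [piOp_signedArc_single hn hj1]
  simp only [map_smul]
  by_cases h : i ∈ Des (simpleB n) (x : hyperoctahedralGroup n)
  · simp only [piOp_single_of_mem_Des h, piOp_signedArc_single hn hj1, map_neg, map_smul,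
      smul_neg]
  by_cases hX : simpleB n i * (x : hyperoctahedralGroup n) ∈ signedArc n
  · rw [piOp_single_of_mul_mem h hX]
    have hy := piOp_single_of_mem_Des (X := signedArc n) (x := ⟨_, hX⟩)
      (mem_Des_simpleB_mul_self h)
    simp only [piOp_signedArc_single hn hj1, map_smul, hy, smul_neg, smul_smul, map_neg]
    -- If `d` and `d'` are the eigenvalues of `π_1` at `x` and `s_0 x`, the two sides are `-d d'`
    -- and `d'` times `s_0 x`, so `d' = -1` must force `d = -1`. It does: `w⁻¹(2) < -w⁻¹(1) <
    -- w⁻¹(1)`, as `0` is an ascent of `x`.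
    have hdes : j ∈ Des (simpleB n) (simpleB n i * (x : hyperoctahedralGroup n)) →
        j ∈ Des (simpleB n) (x : hyperoctahedralGroup n) := by
      have hij : (j : ℕ) = i + 1 := by omega
      rw [mem_Des_succ_iff hij, mem_Des_succ_iff hij, simpleB_mul_inv_apply,
        simpleB_mul_inv_apply, simplePerm_zero_apply_pos hi,
        simplePerm_zero_apply_pos_of_one_le hi (by omega), hyperoctahedral_inv_neg,
        PM.coe_neg]
      rw [zero_notMem_Des_iff hi] at h
      omega
    congr 2
    unfold diagEigenvalue
    split_ifs <;> simp_all
  · simp only [piOp_single_of_mul_notMem h hX, map_zero, smul_zero]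

/-- The action of the 0-Hecke algebra on the span of the signed arc permutations. -/
def signedArcRep (n : ℕ) : HeckeB n →ₐ[ℂ] Module.End ℂ (signedArc n →₀ ℂ) :=
  RingQuot.liftAlgHom ℂ ⟨FreeAlgebra.lift ℂ (piOp (simpleB n) (signedArc n)), by
    intro a b h
    cases h with
    | quad i => simpa using piOp_mul_self _ i
    | comm i j h => simpa using piOp_signedArc_comm h
    | braid i j hi h => simpa using piOp_signedArc_braid hi h
    | braid₄ i j hi hj => simpa using piOp_signedArc_braid₄ hi hj⟩

theorem signedArcRep_gen (i : Fin n) :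
    signedArcRep n (HeckeB.gen i) = piOp (simpleB n) (signedArc n) i := by
  simp [signedArcRep, HeckeB.gen]

end HeckeAction

/-! ### Classes of triangular modules in the Grothendieck group. -/

section Grothendieck

theorem FDModule.cls_eq_add {A : Type} [Ring A] [Algebra ℂ A] {M N P : FDModule A}
    (f : M.carrier →ₗ[A] N.carrier) (g : N.carrier →ₗ[A] P.carrier) (hf : Function.Injective f)
    (hfg : Function.Exact f g) (hg : Function.Surjective g) : N.cls = M.cls + P.cls := by
  have h : (QuotientAddGroup.mk (FreeAbelianGroup.of M - FreeAbelianGroup.of N +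
      FreeAbelianGroup.of P) : GrothendieckGroup₀ A) = 0 :=
    (QuotientAddGroup.eq_zero_iff _).2 (AddSubgroup.subset_closure ⟨M, N, P, f, g, hf, hfg, hg, rfl⟩)
  have h' : M.cls - N.cls + P.cls = 0 := h
  rw [sub_add_eq_add_sub, sub_eq_zero] at h'
  exact h'.symm

/-- For a zero module the sequence `N → N → N` of identities is short exact, so `[N] = [N] + [N]`.
-/
theorem FDModule.cls_eq_zero {A : Type} [Ring A] [Algebra ℂ A] (N : FDModule A)
    [Subsingleton N.carrier] : N.cls = 0 := by
  have := FDModule.cls_eq_add (M := N) (N := N) (P := N) LinearMap.id LinearMap.id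
    Function.injective_id (fun y => ⟨fun _ => ⟨y, rfl⟩, fun _ => Subsingleton.elim _ _⟩)
    Function.surjective_id
  simpa using this

variable {n : ℕ}

theorem HeckeB.induction {p : HeckeB n → Prop} (hC : ∀ c : ℂ, p (algebraMap ℂ _ c))
    (hgen : ∀ i, p (HeckeB.gen i)) (hmul : ∀ a b, p a → p b → p (a * b))
    (hadd : ∀ a b, p a → p b → p (a + b)) (a : HeckeB n) : p a := by
  obtain ⟨x, rfl⟩ := RingQuot.mkAlgHom_surjective ℂ (HeckeBRel n) a
  induction x using FreeAlgebra.induction with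
  | grade0 c => rw [AlgHom.commutes]; exact hC c
  | grade1 i => exact hgen i
  | mul a b ha hb => rw [map_mul]; exact hmul _ _ ha hb
  | add a b ha hb => rw [map_add]; exact hadd _ _ ha hb

open Classical in
/-- A module with a basis on which the generators act triangularly has the class of the sum of the
simple modules read off from the diagonal. -/
theorem FDModule.cls_eq_sum_of_triangular {X : Type} [Fintype X] (M : FDModule (HeckeB n))
    (b : Module.Basis X ℂ M.carrier) (len : X → ℕ) (D : X → Set (Fin n))
    (h : ∀ i x, HeckeB.gen i • b x - (if i ∈ D x then (-1 : ℂ) else 0) • b x ∈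
      Submodule.span ℂ (b '' {y | len x < len y})) :
    M.cls = ∑ x, (simpleModuleB (D x)).cls := by
  -- Submodules spanned by basis vectors are represented by injective maps into `M`, so that the
  -- induction can pass to kernels.
  suffices H : ∀ (T : Finset X) (N : FDModule (HeckeB n)) (f : N.carrier →ₗ[HeckeB n] M.carrier),
      Function.Injective f → (∀ m, m ∈ Set.range f ↔ m ∈ Submodule.span ℂ (b '' (T : Set X))) →
      N.cls = ∑ x ∈ T, (simpleModuleB (D x)).cls by
    refine H Finset.univ M LinearMap.id Function.injective_id fun m => ?_
    simp [b.span_eq]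
  intro T
  induction T using Finset.induction_on_min_value len with
  | empty =>
    intro N f hf hr
    have : Subsingleton N.carrier := ⟨fun v w => hf (by
      have h0 : ∀ v, f v = 0 := fun v => by simpa using (hr (f v)).1 ⟨v, rfl⟩
      rw [h0, h0])⟩
    simpa using N.cls_eq_zero
  | insert x T hx hmin ih =>
    intro N f hf hr
    -- Since `x` has least length among the remaining indices, no off-diagonal term contributes to
    -- the coordinate at `x`; that coordinate is a module map to `𝒮_{D(x)}`.
    have hgen : ∀ (i : Fin n) (v : N.carrier), b.coord x (f (HeckeB.gen i • v)) =
        (if i ∈ D x then (-1 : ℂ) else 0) * b.coord x (f v) := by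
      intro i v
      rw [map_smul]
      have hv := (hr (f v)).1 ⟨v, rfl⟩
      generalize f v = m at hv
      induction hv using Submodule.span_induction with
      | mem m hm =>
        obtain ⟨y, hy, rfl⟩ := hm
        have hxy : len x ≤ len y := by
          rcases Finset.mem_insert.1 (Finset.mem_coe.1 hy) with rfl | hy
          · exact le_rfl
          · exact hmin y hy
        have h0 : b.coord x (HeckeB.gen i • b y - (if i ∈ D y then (-1 : ℂ) else 0) • b y) = 0 := by
          rw [Module.Basis.coord_apply]
          by_contra hne
          have := b.mem_span_image.1 (h i y) (Finsupp.mem_support_iff.2 hne)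
          exact absurd this (not_lt.2 hxy)
        rw [map_sub, sub_eq_zero, (b.coord x).map_smul, smul_eq_mul] at h0
        rw [h0]
        by_cases hxy : y = x
        · rw [hxy]
        · simp [hxy]
      | zero => simp
      | add a c _ _ ha hc => rw [smul_add, map_add, map_add, ha, hc, mul_add]
      | smul c m _ hm => rw [smul_comm, (b.coord x).map_smul, (b.coord x).map_smul, hm, mul_smul_comm]
    have hall : ∀ (a : HeckeB n) (v : N.carrier), b.coord x (f (a • v)) =
        HeckeB.simpleChar (D x) a * b.coord x (f v) := by
      intro a
      induction a using HeckeB.induction with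
      | hC c =>
        intro v
        rw [map_smul, algebraMap_smul, map_smul, AlgHom.commutes]
        rfl
      | hgen i => intro v; rw [hgen, HeckeB.simpleChar_gen]
      | hmul a c ha hc => intro v; rw [mul_smul, ha, hc, map_mul, mul_assoc]
      | hadd a c ha hc => intro v; rw [add_smul, map_add, map_add, ha, hc, map_add, add_mul]
    let g : N.carrier →ₗ[HeckeB n] (simpleModuleB (D x)).carrier :=
      { toFun := fun v => (b.coord x (f v) : ℂ)
        map_add' := fun v w => by rw [map_add, map_add]; rfl
        map_smul' := fun a v => hall a v }
    have hg : ∀ v, g v = b.coord x (f v) := fun _ => rfl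
    -- The kernel of this coordinate is spanned by the basis vectors indexed by `T`, which feeds the
    -- induction.
    let K : FDModule (HeckeB n) :=
      haveI : Module.Finite ℂ (LinearMap.ker g) :=
        inferInstanceAs (Module.Finite ℂ ((LinearMap.ker g).restrictScalars ℂ))
      { carrier := LinearMap.ker g }
    have hK := ih K (f ∘ₗ (LinearMap.ker g).subtype) (hf.comp Subtype.val_injective) fun m => by
      constructor
      · rintro ⟨⟨v, hv⟩, rfl⟩
        have h1 := b.mem_span_image.1 ((hr (f v)).1 ⟨v, rfl⟩)
        refine b.mem_span_image.2 fun y hy => ?_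
        have hy' := h1 hy
        rw [Finset.coe_insert] at hy'
        refine hy'.resolve_left fun hyx => ?_
        rw [hyx] at hy
        exact Finsupp.mem_support_iff.1 hy hv
      · intro hm
        obtain ⟨v, hv⟩ := (hr m).2 (Submodule.span_mono
          (Set.image_mono (by simp)) hm)
        refine ⟨⟨v, ?_⟩, hv⟩
        change b.coord x (f v) = 0
        rw [hv]
        by_contra hne
        exact hx (b.mem_span_image.1 hm (Finsupp.mem_support_iff.2 hne))
    rw [Finset.sum_insert hx, add_comm, ← hK]
    refine FDModule.cls_eq_add (M := K) (LinearMap.ker g).subtype g Subtype.val_injective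
      (LinearMap.exact_subtype_ker_map g) fun c => ?_
    obtain ⟨v, hv⟩ := (hr (b x)).2 (Submodule.subset_span ⟨x, by simp, rfl⟩)
    refine ⟨algebraMap ℂ (HeckeB n) c • v, ?_⟩
    rw [hg, hall, hv]
    change HeckeB.simpleChar (D x) (algebraMap ℂ (HeckeB n) c) * b.coord x (b x) = (c : ℂ)
    rw [Module.Basis.coord_apply, Module.Basis.repr_self, Finsupp.single_eq_same, mul_one]
    exact AlgHom.commutes _ _

end Grothendieck

/-! ### The characteristic of the module of signed arc permutations. -/

theorem QB_inv {n : ℕ} (X : Set (hyperoctahedralGroup n)) [Fintype X] :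
    QB X⁻¹ = ∑ x : X, fundamentalB (Des (simpleB n) (x : hyperoctahedralGroup n)) := by
  unfold QB
  rw [← Set.image_inv_eq_inv, finsum_mem_image inv_injective.injOn]
  simp only [inv_inv]
  rw [finsum_mem_eq_finite_toFinset_sum _ X.toFinite]
  exact (Finset.sum_subtype _ (by simp) _)

open Classical in
/-- The operators `π_i` are triangular with respect to the length. -/
theorem signedArcRep_gen_sub_mem {n : ℕ} (i : Fin n) (x : signedArc n) :
    signedArcRep n (HeckeB.gen i) (Finsupp.basisSingleOne x) -
        (if i ∈ Des (simpleB n) (x : hyperoctahedralGroup n) then (-1 : ℂ) else 0) •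
          Finsupp.basisSingleOne x ∈
      Submodule.span ℂ ((Finsupp.basisSingleOne : Module.Basis (signedArc n) ℂ _) ''
        {y | wordLength (simpleB n) (x : hyperoctahedralGroup n) <
          wordLength (simpleB n) (y : hyperoctahedralGroup n)}) := by
  rw [signedArcRep_gen, Finsupp.coe_basisSingleOne]
  split_ifs with h
  · rw [piOp_single_of_mem_Des h, neg_one_smul, sub_self]
    exact zero_mem _
  rw [zero_smul, sub_zero]
  by_cases hX : simpleB n i * (x : hyperoctahedralGroup n) ∈ signedArc n
  · rw [piOp_single_of_mul_mem h hX]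
    refine Submodule.subset_span ⟨⟨_, hX⟩, ?_, by simp⟩
    change _ < wordLength (simpleB n) (simpleB n i * (x : hyperoctahedralGroup n))
    rw [wordLength_simpleB_mul h]
    exact Nat.lt_succ_self _
  · rw [piOp_single_of_mul_notMem h hX]
    exact zero_mem _

theorem signedArc_cls (n : ℕ) [Fintype (signedArc n)] :
    (FDModule.ofRep (signedArcRep n)).cls = ∑ x : signedArc n,
      (simpleModuleB (Des (simpleB n) (x : hyperoctahedralGroup n))).cls := by
  refine FDModule.cls_eq_sum_of_triangular (FDModule.ofRep (signedArcRep n))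
    (Finsupp.basisSingleOne : Module.Basis (signedArc n) ℂ (signedArc n →₀ ℂ))
    (fun x => wordLength (simpleB n) (x : hyperoctahedralGroup n)) _ fun i x => ?_
  exact signedArcRep_gen_sub_mem i x

end
theorem mainTheorem11 (n : ℕ) :
    AscentCompatible (simpleB n) (signedArc n) ∧
    (3 ≤ n → ¬ LeftWeakConvex (simpleB n) (signedArc n)) ∧
    ∃ ρ : HeckeB n →ₐ[ℂ] Module.End ℂ (signedArc n →₀ ℂ),
      (∀ i : Fin n, ρ (HeckeB.gen i) = piOp (simpleB n) (signedArc n) i) ∧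
      chB n (FDModule.ofRep ρ).cls = QB (signedArc n)⁻¹ := by
  classical
  have := Fintype.ofFinite (signedArc n)
  refine ⟨ascentCompatible_signedArc, not_leftWeakConvex_signedArc, signedArcRep n,
    signedArcRep_gen, ?_⟩
  rw [signedArc_cls, map_sum, QB_inv]
  exact Finset.sum_congr rfl fun x _ => chB_simple _
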